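/- \textbf{Model.} Macro base stations form a homogeneous Poisson point process $\Phi_1$ of density $\lambda_1>0$ on $\mathbb R^2$; the typical user is at the origin. Each station carries a random cache content, and the contents are i.i.d. over the stations; $p_{1,f}\in[0,1]$ is the probability that a station stores the $f$-th file. The small fading terms $h_x$ are independent with $|h_x|^2\sim\mathrm{Exp}(1)$ (Rayleigh fading). Locations, cache contents and fading terms are mutually independent. Let $P_1,C_1>0$ be the transmit power and the path loss intercept, $\alpha_1>2$ the path loss exponent, $L_1(r)=C_1r^{-\alpha_1}$, $N_1\ge1$ the number of antenna elements, $G_0=1$ the serving gain, $\sigma_1^2\ge 0$ the noise power. The interferers have array gain $1$. Let $\Phi_{1,f}\subset\Phi_1$ be the set of stations storing file $f$, $\Phi_{1,f'}=\Phi_1\setminus\Phi_{1,f}$, and let the user be served by the station $x_0\in\Phi_{1,f}$ nearest to the origin. Put $$\Upsilon_{1,f}=\frac{P_1L_1(\|x_0\|)G_0N_1|h_{x_0}|^2}{\sigma_1^2+\sum_{x\in\Phi_{1,f}\setminus\{x_0\}}P_1L_1(\|x\|)N_1|h_x|^2+\sum_{x\in\Phi_{1,f'}}P_1L_1(\|x\|)N_1|h_x|^2}.$$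 \textbf{Theorem.} For every file $f$ and every threshold $\tau\ge0$, the cache-related SINR coverage probability (the user counting as not covered if $\Phi_{1,f}=\emptyset$) is exactly $$\mathbb P[\Upsilon_{1,f}>\tau]=\int_0^\infty\exp\Big(-\frac{\tau\sigma_1^2r^{\alpha_1}}{P_1C_1N_1G_0}-\pi\lambda_1r^2\big(p_{1,f}(S_1^0(\tau)-1)+(1-p_{1,f})\Delta_1(\tau)\big)\Big)P_{1,f}(r)\,dr,$$ where the integral converges, $P_{1,f}(r)=2\pi p_{1,f}\lambda_1r\exp(-\pi p_{1,f}\lambda_1r^2)$, $S_1^0(z)={}_2F_1\big(-\tfrac2{\alpha_1},1;1-\tfrac2{\alpha_1};-z\big)$ with ${}_2F_1$ the Gauss hypergeometric function (principal branch on $\mathbb C\setminus[1,\infty)$), and $\Delta_1(z)=\Gamma\big(1-\tfrac2{\alpha_1}\big)\Gamma\big(1+\tfrac2{\alpha_1}\big)z^{2/\alpha_1}$. -/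

import Mathlib

open MeasureTheory ProbabilityTheory

/-! ### Poisson point processes -/

/-- `Φ` is a Poisson point process with intensity measure `Λ`: the number of points in a measurable
set `B` of finite intensity is Poisson distributed with mean `Λ B`, and the numbers of points in
finitely many pairwise disjoint measurable sets are independent. A realization `Φ ω` is the
counting measure of the set of points. -/
structure IsPoissonProcess {Ω E : Type*} [MeasurableSpace Ω] [MeasurableSpace E]
    (Λ : Measure E) (Φ : Ω → Measure E) (μ : Measure Ω) : Prop where
  count_law : ∀ B : Set E, MeasurableSet B → Λ B ≠ ⊤ →
    HasLaw (fun ω => Φ ω B)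
      ((poissonMeasure (Λ B).toNNReal).map (Nat.cast : ℕ → ENNReal)) μ
  count_indep : ∀ (n : ℕ) (B : Fin n → Set E), (∀ i, MeasurableSet (B i)) →
    Pairwise (fun i j => Disjoint (B i) (B j)) → iIndepFun (fun i ω => Φ ω (B i)) μ

/-! ### The macro tier -/

/-- The plane, with its Euclidean norm. The typical user sits at the origin. -/
abbrev Plane : Type := EuclideanSpace ℝ (Fin 2)

/-- The random macro tier. The base stations are enumerated as `X 0, X 1, …` and form a homogeneous
Poisson process of density `lam` on the plane; `cache k ω g = true` says that the `k`-th station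
stores the `g`-th of the `Nc` files; `h k` is the small fading term of its channel to the typical
user. The cache contents are i.i.d. with law `ν`, the fading terms are independent with
`|h k|² ∼ Exp(1)` (Rayleigh fading), and locations, caches and fading are mutually independent. -/
structure IsMacroTier {Ω : Type*} [MeasurableSpace Ω] (μ : Measure Ω) {Nc : ℕ} (lam : ℝ)
    (ν : Measure (Fin Nc → Bool)) (X : ℕ → Ω → Plane) (cache : ℕ → Ω → Fin Nc → Bool)
    (h : ℕ → Ω → ℂ) : Prop where
  measurable_location : ∀ k, Measurable (X k)
  measurable_cache : ∀ k, Measurable (cache k)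
  measurable_fading : ∀ k, Measurable (h k)
  poisson : IsPoissonProcess (ENNReal.ofReal lam • (volume : Measure Plane))
    (fun ω => Measure.sum fun k => Measure.dirac (X k ω)) μ
  cache_law : ∀ k, HasLaw (cache k) ν μ
  cache_indep : iIndepFun cache μ
  fading_law : ∀ k, HasLaw (fun ω => ‖h k ω‖ ^ 2) (expMeasure 1) μ
  fading_indep : iIndepFun h μ
  indep_cache_fading : IndepFun (fun ω k => cache k ω) (fun ω k => h k ω) μ
  indep_location_marks :
    IndepFun (fun ω k => X k ω) (fun ω => (fun k => cache k ω, fun k => h k ω)) μ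

/-- The probability that a station stores the file `f`. -/
noncomputable def cacheProb {Nc : ℕ} (ν : Measure (Fin Nc → Bool)) (f : Fin Nc) : ℝ :=
  ν.real {c | c f = true}

/-- The path loss law `L₁(r) = C r^(-α)`. -/
noncomputable def pathLoss (C α r : ℝ) : ℝ := C * r ^ (-α)

/-- The directivity gain `G₀ = 1` of the serving station. -/
def servingGain : ℝ := 1

/-- The array gain `G₁ = 1` of the omnidirectional macro antennas. -/
def omniGain : ℝ := 1

/-- The power received at the origin from the interfering station `k`:
`P L₁(‖x‖) H` with `H = N |h|² G₁`. -/
noncomputable def interferingPower {Ω : Type*} (P C α : ℝ) (N : ℕ) (X : ℕ → Ω → Plane)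
    (h : ℕ → Ω → ℂ) (k : ℕ) (ω : Ω) : ℝ :=
  P * pathLoss C α ‖X k ω‖ * (N * ‖h k ω‖ ^ 2 * omniGain)

open Classical in
/-- Interference from the stations other than `k` that store the file `f`. -/
noncomputable def interferenceCaching {Ω : Type*} {Nc : ℕ} (P C α : ℝ) (N : ℕ) (X : ℕ → Ω → Plane)
    (cache : ℕ → Ω → Fin Nc → Bool) (h : ℕ → Ω → ℂ) (f : Fin Nc) (k : ℕ) (ω : Ω) : ENNReal :=
  ∑' j, if cache j ω f = true ∧ j ≠ k then
    ENNReal.ofReal (interferingPower P C α N X h j ω) else 0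

open Classical in
/-- Interference from the stations that do not store the file `f`. -/
noncomputable def interferenceNonCaching {Ω : Type*} {Nc : ℕ} (P C α : ℝ) (N : ℕ)
    (X : ℕ → Ω → Plane) (cache : ℕ → Ω → Fin Nc → Bool) (h : ℕ → Ω → ℂ) (f : Fin Nc) (ω : Ω) :
    ENNReal :=
  ∑' j, if cache j ω f = false then
    ENNReal.ofReal (interferingPower P C α N X h j ω) else 0

/-- The SINR of the typical user when it is served by the station `k`, requesting the file `f`. -/
noncomputable def sinr {Ω : Type*} {Nc : ℕ} (P C α σ : ℝ) (N : ℕ) (X : ℕ → Ω → Plane)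
    (cache : ℕ → Ω → Fin Nc → Bool) (h : ℕ → Ω → ℂ) (f : Fin Nc) (k : ℕ) (ω : Ω) : ENNReal :=
  ENNReal.ofReal (P * pathLoss C α ‖X k ω‖ * servingGain * N * ‖h k ω‖ ^ 2) /
    (ENNReal.ofReal (σ ^ 2) + interferenceCaching P C α N X cache h f k ω +
      interferenceNonCaching P C α N X cache h f ω)

/-- The station `k` is a nearest one to the origin among those storing the file `f`. -/
def IsServing {Ω : Type*} {Nc : ℕ} (X : ℕ → Ω → Plane) (cache : ℕ → Ω → Fin Nc → Bool)
    (f : Fin Nc) (k : ℕ) (ω : Ω) : Prop :=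
  cache k ω f = true ∧ ∀ j, cache j ω f = true → ‖X k ω‖ ≤ ‖X j ω‖

/-- The probability that the user has a serving station and that its SINR exceeds `τ`. -/
noncomputable def coverageProb {Ω : Type*} [MeasurableSpace Ω] (μ : Measure Ω) {Nc : ℕ}
    (P C α σ : ℝ) (N : ℕ) (X : ℕ → Ω → Plane) (cache : ℕ → Ω → Fin Nc → Bool) (h : ℕ → Ω → ℂ)
    (f : Fin Nc) (τ : ℝ) : ℝ :=
  μ.real {ω | ∃ k, IsServing X cache f k ω ∧
    ENNReal.ofReal τ < sinr P C α σ N X cache h f k ω}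

/-! ### Special functions -/

/-- The plane cut along `[1, ∞)`. -/
def hypergeometricDomain : Set ℂ := {z | ¬ (1 ≤ z.re ∧ z.im = 0)}

open Classical in
/-- The Gauss hypergeometric function (principal branch): the analytic continuation of the
hypergeometric series from the unit disc to the plane cut along `[1, ∞)`. (The function `₂F₁` of
the library is the sum of the series and has no meaning outside the unit disc.) -/
noncomputable def gaussHypergeometric (a b c z : ℂ) : ℂ :=
  if H : ∃ F : ℂ → ℂ, DifferentiableOn ℂ F hypergeometricDomain ∧
      ∀ w : ℂ, ‖w‖ < 1 → F w = ordinaryHypergeometric a b c w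
  then H.choose z else 0

/-- The continuation is unique, so that the choice above does not matter. -/
theorem gaussHypergeometric_eq {a b c : ℂ} {F : ℂ → ℂ}
    (hF : DifferentiableOn ℂ F hypergeometricDomain)
    (hF' : ∀ w : ℂ, ‖w‖ < 1 → F w = ordinaryHypergeometric a b c w) {z : ℂ}
    (hz : z ∈ hypergeometricDomain) : gaussHypergeometric a b c z = F z := by
  have H : ∃ F : ℂ → ℂ, DifferentiableOn ℂ F hypergeometricDomain ∧
      ∀ w : ℂ, ‖w‖ < 1 → F w = ordinaryHypergeometric a b c w := ⟨F, hF, hF'⟩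
  have hopen : IsOpen hypergeometricDomain := by
    have : hypergeometricDomain = ({z : ℂ | 1 ≤ z.re} ∩ {z : ℂ | z.im = 0})ᶜ := rfl
    rw [this, isOpen_compl_iff]
    exact (isClosed_le continuous_const Complex.continuous_re).inter
      (isClosed_eq Complex.continuous_im continuous_const)
  have h0 : (0 : ℂ) ∈ hypergeometricDomain := by simp [hypergeometricDomain]
  have hstar : StarConvex ℝ (0 : ℂ) hypergeometricDomain := by
    rw [starConvex_zero_iff]
    rintro x hx t ht0 ht1 ⟨h1, h2⟩
    simp only [Complex.real_smul, Complex.mul_re, Complex.mul_im, Complex.ofReal_re,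
      Complex.ofReal_im, zero_mul, sub_zero, add_zero] at h1 h2
    have ht : t ≠ 0 := by
      rintro rfl
      norm_num at h1
    refine hx ⟨?_, (mul_eq_zero.1 h2).resolve_left ht⟩
    nlinarith [lt_of_le_of_ne ht0 ht.symm]
  have key := (H.choose_spec.1.analyticOnNhd hopen).eqOn_of_preconnected_of_eventuallyEq
    (hF.analyticOnNhd hopen) (hstar.isPathConnected h0).isConnected.isPreconnected h0
    (Filter.eventuallyEq_of_mem (Metric.ball_mem_nhds (0 : ℂ) one_pos) fun w hw => by
      rw [H.choose_spec.2 w (by simpa using hw), hF' w (by simpa using hw)])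
  rw [gaussHypergeometric, dif_pos H]
  exact key hz

/-- `S^k(z) = ₂F₁(k - 2/α, k + Np; k + 1 - 2/α; -z)`, where `α` is the path loss exponent and `Np`
the fading parameter of the tier. -/
noncomputable def hyperS (k Np : ℕ) (α z : ℝ) : ℝ :=
  (gaussHypergeometric ((k - 2 / α : ℝ) : ℂ) ((k + Np : ℝ) : ℂ) ((k + 1 - 2 / α : ℝ) : ℂ)
    ((-z : ℝ) : ℂ)).re

/-- `Δ(z) = Γ(1 - 2/α) Γ(Np + 2/α) Γ(Np)⁻¹ z^(2/α)`. -/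
noncomputable def gammaDelta (Np : ℕ) (α z : ℝ) : ℝ :=
  Real.Gamma (1 - 2 / α) * Real.Gamma (Np + 2 / α) * (Real.Gamma Np)⁻¹ * z ^ (2 / α)

/-- The density `2π p λ r exp(-π p λ r²)` of the distance to the nearest caching station. -/
noncomputable def nearestDensity (p lam r : ℝ) : ℝ :=
  2 * Real.pi * p * lam * r * Real.exp (-(Real.pi * p * lam * r ^ 2))

/-- The integrand of the coverage formula, for the fading parameter `1` of Rayleigh fading. -/
noncomputable def coverageIntegrand (P C α σ lam p τ : ℝ) (N : ℕ) (r : ℝ) : ℝ :=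
  Real.exp (-(τ * σ ^ 2 * r ^ α / (P * C * N * servingGain)) -
      Real.pi * lam * r ^ 2 * (p * (hyperS 0 1 α τ - 1) + (1 - p) * gammaDelta 1 α τ)) *
    nearestDensity p lam r

open scoped ENNReal NNReal Topology
open Filter Set

/-! ### The exponential `x ↦ exp (-x)` on `[0, ∞]` -/

/-! Rayleigh fading turns coverage into a Laplace transform. Fix the locations and consider the
`k`-th station, at distance `a > 0`. It serves if it stores the file, which has probability `p`, and
no nearer station does, which costs a factor `1 - p` for each nearer station. As soon as it stores
the file, the two interference sums add up to the power of all other stations, so the SINR no longer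
involves the caches. Its exponential fading exceeds a given level `y` with probability `exp (-y)`;
averaging over the independent fading of the others gives a noise factor and a factor `(1 + τ a^α
b^(-α))⁻¹` for each station at distance `b`. So the conditional probability is `p`, times the noise
factor, times the exponential of minus the sum of the `stationCost`s of the other stations
(`measure_isServing_and_lt_sinr_const`).

Almost surely no two stations are equally far, so the events for different `k` are disjoint and the
coverage probability is a sum over `k`. The Campbell–Mecke formula
(`tsum_lintegral_mul_negExp_mono`) evaluates it: seen from one of its points, the rest of a Poisson
process is again that Poisson process, so the sum becomes an integral over the plane in which the
other stations enter through their Laplace functional. The formula is obtained from the counting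
axioms: independence and the Poisson law give the Laplace functional at simple functions, monotone
limits give it in general, and its derivative in the direction of an indicator is Campbell–Mecke.

It remains to compute. In the variable `v = (a / b) ^ α` the Laplace exponent is `π λ a² (p S + (1 -
p) Δ)` (`lintegral_radial_exponent`), where `S - 1` is Euler's integral over `(0, 1)` and `Δ` a beta
integral over the half-line. The `1` in `S = 1 + (S - 1)` accounts for the absence of nearer caching
stations and supplies the exponential in the density of the serving distance.

Everything is done in `[0, ∞]`: infinite products are exponentials of sums, so no convergence has to
be discussed, and for `p = 1` the cost `⊤` encodes the factor `0`. -/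

/-- The map `x ↦ exp (-x)` on `[0, ∞]`, with `exp (-∞) = 0`. -/
noncomputable def negExp (x : ℝ≥0∞) : ℝ≥0∞ := EReal.exp (-(x : EReal))

/-- The map `y ↦ -log y` on `[0, 1]`, with `-log 0 = ∞`. -/
noncomputable def negLog (y : ℝ≥0∞) : ℝ≥0∞ := (-ENNReal.log y).toENNReal

@[simp] lemma negExp_zero : negExp 0 = 1 := by simp [negExp]

@[simp] lemma negExp_top : negExp ⊤ = 0 := by simp [negExp]

lemma negExp_ofReal {t : ℝ} (ht : 0 ≤ t) :
    negExp (ENNReal.ofReal t) = ENNReal.ofReal (Real.exp (-t)) := by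
  rw [negExp, EReal.coe_ennreal_ofReal, max_eq_left ht, ← EReal.coe_neg, EReal.exp_coe]

lemma negExp_eq_ofReal {x : ℝ≥0∞} (hx : x ≠ ⊤) :
    negExp x = ENNReal.ofReal (Real.exp (-x.toReal)) := by
  rw [← negExp_ofReal ENNReal.toReal_nonneg, ENNReal.ofReal_toReal hx]

lemma negExp_add (x y : ℝ≥0∞) : negExp (x + y) = negExp x * negExp y := by
  have : -((x + y : ℝ≥0∞) : EReal) = -(x : EReal) + -(y : EReal) := by
    rw [EReal.coe_ennreal_add, EReal.neg_add (by simp) (by simp), sub_eq_add_neg]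
  rw [negExp, this, EReal.exp_add, negExp, negExp]

lemma antitone_negExp : Antitone negExp := fun x y h => by
  simp only [negExp, EReal.exp_le_exp_iff, EReal.neg_le_neg_iff]
  exact_mod_cast h

lemma negExp_le_one (x : ℝ≥0∞) : negExp x ≤ 1 := by
  simpa using antitone_negExp (zero_le : 0 ≤ x)

lemma negExp_ne_top (x : ℝ≥0∞) : negExp x ≠ ⊤ := ((negExp_le_one x).trans_lt ENNReal.one_lt_top).ne

lemma negExp_ne_zero {x : ℝ≥0∞} (hx : x ≠ ⊤) : negExp x ≠ 0 := by
  simp [negExp_eq_ofReal hx, Real.exp_pos]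

lemma continuous_negExp : Continuous negExp :=
  ENNReal.continuous_exp.comp (continuous_neg.comp continuous_coe_ennreal_ereal)

@[fun_prop] lemma measurable_negExp : Measurable negExp := continuous_negExp.measurable

lemma negExp_sum {ι : Type*} (s : Finset ι) (f : ι → ℝ≥0∞) :
    negExp (∑ i ∈ s, f i) = ∏ i ∈ s, negExp (f i) := by
  classical
  induction s using Finset.induction_on with
  | empty => simp
  | insert i s hi ih => rw [Finset.sum_insert hi, Finset.prod_insert hi, negExp_add, ih]

lemma negExp_mul_natCast (c : ℝ≥0∞) (n : ℕ) : negExp (c * n) = negExp c ^ n := by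
  have := negExp_sum (Finset.range n) fun _ => c
  simpa [mul_comm] using this

/-- For `y ≤ 1` the number `-log y` is nonnegative, so the truncation hidden in `toENNReal` does
nothing. -/
lemma negExp_negLog {y : ℝ≥0∞} (hy : y ≤ 1) : negExp (negLog y) = y := by
  have h : 0 ≤ -ENNReal.log y := by
    rw [EReal.le_neg, neg_zero]; exact ENNReal.log_le_zero_iff.2 hy
  rw [negExp, negLog, EReal.coe_toENNReal h, neg_neg, ENNReal.exp_log]

lemma tendsto_negExp_sum_range (f : ℕ → ℝ≥0∞) :
    Tendsto (fun n => ∏ i ∈ Finset.range n, negExp (f i)) atTop (𝓝 (negExp (∑' i, f i))) := by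
  simp_rw [← negExp_sum]
  exact (continuous_negExp.tendsto _).comp (ENNReal.tendsto_nat_tsum f)

/-! ### Slopes at zero, along the sequence `1 / (n + 1)` -/

lemma tendsto_mul_ofReal_of_hasDerivAt {g : ℝ → ℝ} {y : ℝ} (hg : HasDerivAt g y 0)
    (hg0 : g 0 = 0) :
    Tendsto (fun n : ℕ => ENNReal.ofReal (g ((n : ℝ) + 1)⁻¹) * (n + 1)) atTop
      (𝓝 (ENNReal.ofReal y)) := by
  have hs : Tendsto (fun n : ℕ => ((n : ℝ) + 1)⁻¹) atTop (𝓝[>] 0) := by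
    refine tendsto_nhdsWithin_iff.2 ⟨?_, Eventually.of_forall fun n => by
      simp only [mem_Ioi]; positivity⟩
    simpa using tendsto_one_div_add_atTop_nhds_zero_nat (𝕜 := ℝ)
  refine (ENNReal.tendsto_ofReal ((hg.tendsto_slope_zero_right).comp hs)).congr fun n => ?_
  have hn : (n : ℝ≥0∞) + 1 = ENNReal.ofReal ((n : ℝ) + 1) := by
    rw [ENNReal.ofReal_add (by positivity) zero_le_one]; simp
  rw [hn, ← ENNReal.ofReal_mul' (by positivity)]
  simp [hg0, mul_comm]

lemma natCast_add_one_inv_eq_ofReal (n : ℕ) :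
    ((n : ℝ≥0∞) + 1)⁻¹ = ENNReal.ofReal ((n : ℝ) + 1)⁻¹ := by
  rw [ENNReal.ofReal_inv_of_pos (by positivity), ENNReal.ofReal_add (by positivity) zero_le_one]
  simp

lemma one_sub_negExp_ofReal {t : ℝ} (ht : 0 ≤ t) :
    1 - negExp (ENNReal.ofReal t) = ENNReal.ofReal (1 - Real.exp (-t)) := by
  rw [negExp_ofReal ht, ← ENNReal.ofReal_one, ← ENNReal.ofReal_sub _ (Real.exp_nonneg _)]

/-- The slope at `0` of `t ↦ 1 - exp (-t y)`. -/
lemma tendsto_one_sub_negExp_mul (y : ℝ≥0∞) :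
    Tendsto (fun n : ℕ => (1 - negExp ((n + 1 : ℝ≥0∞)⁻¹ * y)) * (n + 1)) atTop (𝓝 y) := by
  rcases eq_or_ne y ⊤ with rfl | hy
  · have h : ∀ n : ℕ, ((n : ℝ≥0∞) + 1)⁻¹ * ⊤ = ⊤ := fun n => ENNReal.mul_top (by simp)
    simp only [h, negExp_top, tsub_zero, one_mul]
    have := ENNReal.tendsto_nat_nhds_top.comp (tendsto_add_atTop_nat 1)
    simpa [Function.comp_def] using this
  lift y to ℝ≥0 using hy
  have hd : HasDerivAt (fun t : ℝ => 1 - Real.exp (-(t * y))) y 0 := by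
    simpa using ((((hasDerivAt_id (0 : ℝ)).mul_const (y : ℝ)).neg).exp).const_sub 1
  have h := tendsto_mul_ofReal_of_hasDerivAt hd (by simp)
  rw [ENNReal.ofReal_coe_nnreal] at h
  refine h.congr fun n => ?_
  rw [natCast_add_one_inv_eq_ofReal, ← ENNReal.ofReal_coe_nnreal,
    ← ENNReal.ofReal_mul (by positivity), one_sub_negExp_ofReal (by positivity)]

/-- The slope at `0` of `t ↦ 1 - exp (-(1 - exp (-t)) y)`. -/
lemma tendsto_one_sub_negExp_one_sub_negExp_mul {y : ℝ≥0∞} (hy : y ≠ ⊤) :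
    Tendsto (fun n : ℕ => (1 - negExp ((1 - negExp (n + 1 : ℝ≥0∞)⁻¹) * y)) * (n + 1))
      atTop (𝓝 y) := by
  lift y to ℝ≥0 using hy
  have hd : HasDerivAt (fun t : ℝ => 1 - Real.exp (-((1 - Real.exp (-t)) * y))) y 0 := by
    have h1 : HasDerivAt (fun t : ℝ => 1 - Real.exp (-t)) 1 0 := by
      simpa using (((hasDerivAt_id (0 : ℝ)).neg).exp).const_sub 1
    simpa using (((h1.mul_const (y : ℝ)).neg).exp).const_sub 1
  have h := tendsto_mul_ofReal_of_hasDerivAt hd (by simp)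
  rw [ENNReal.ofReal_coe_nnreal] at h
  refine h.congr fun n => ?_
  have h0 : 0 ≤ 1 - Real.exp (-((n : ℝ) + 1)⁻¹) := by
    rw [sub_nonneg, Real.exp_le_one_iff, neg_nonpos]; positivity
  rw [natCast_add_one_inv_eq_ofReal, ← ENNReal.ofReal_coe_nnreal,
    one_sub_negExp_ofReal (by positivity), ← ENNReal.ofReal_mul h0,
    one_sub_negExp_ofReal (mul_nonneg h0 y.coe_nonneg)]

lemma one_sub_negExp_le (y : ℝ≥0∞) : 1 - negExp y ≤ y := by
  rcases eq_or_ne y ⊤ with rfl | hy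
  · simp
  rw [negExp_eq_ofReal hy, ← ENNReal.ofReal_one, ← ENNReal.ofReal_sub _ (Real.exp_nonneg _)]
  refine ENNReal.ofReal_le_of_le_toReal ?_
  have := Real.one_sub_le_exp_neg y.toReal
  linarith

/-- The Laplace transform of a sequence of independent `[0, ∞]`-valued random variables. -/
lemma lintegral_negExp_tsum_of_iIndepFun {Ω : Type*} [MeasurableSpace Ω] {μ : Measure Ω}
    {v : ℕ → Ω → ℝ≥0∞} (hv : iIndepFun v μ) (hm : ∀ i, Measurable (v i)) :
    ∫⁻ ω, negExp (∑' i, v i ω) ∂μ = negExp (∑' i, negLog (∫⁻ ω, negExp (v i ω) ∂μ)) := by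
  have := hv.isProbabilityMeasure
  have hle : ∀ i, ∫⁻ ω, negExp (v i ω) ∂μ ≤ 1 := fun i => by
    simpa using lintegral_mono (μ := μ) fun ω => negExp_le_one (v i ω)
  -- The infinite product of the individual transforms is encoded as `negExp` of a sum of `negLog`s,
  -- which always makes sense; only finite products have to be compared.
  have h1 := tendsto_negExp_sum_range fun i => negLog (∫⁻ ω, negExp (v i ω) ∂μ)
  simp_rw [fun i => negExp_negLog (hle i)] at h1
  refine tendsto_nhds_unique ?_ h1
  have h2 : Tendsto (fun n => ∫⁻ ω, ∏ i ∈ Finset.range n, negExp (v i ω) ∂μ) atTop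
      (𝓝 (∫⁻ ω, negExp (∑' i, v i ω) ∂μ)) := by
    refine tendsto_lintegral_of_dominated_convergence (fun _ => 1) (fun n => ?_) (fun n => ?_)
      (by simp) (Eventually.of_forall fun ω => tendsto_negExp_sum_range fun i => v i ω)
    · exact Finset.measurable_prod _ fun i _ => measurable_negExp.comp (hm i)
    · exact Eventually.of_forall fun ω => Finset.prod_le_one' fun i _ => negExp_le_one _
  refine h2.congr fun n => ?_
  exact lintegral_prod_eq_prod_lintegral_of_indepFun _ (fun i ω => negExp (v i ω))
    (hv.comp (fun _ => negExp) fun _ => measurable_negExp) fun i => measurable_negExp.comp (hm i)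

/-! ### The Laplace functional of a Poisson process -/

/-- The generating function of the Poisson law, from the exponential series. The value `q = 0` is
included (with `0 ^ 0 = 1`) and gives the void probability. -/
lemma lintegral_poissonMeasure_pow (m : ℝ≥0) {q : ℝ≥0∞} (hq : q ≤ 1) :
    ∫⁻ n, q ^ n ∂(poissonMeasure m) = negExp ((1 - q) * m) := by
  have hq' : q ≠ ⊤ := (hq.trans_lt ENNReal.one_lt_top).ne
  lift q to ℝ≥0 using hq'
  have hq1 : (q : ℝ) ≤ 1 := by exact_mod_cast hq
  have hs : HasSum (fun n : ℕ => Real.exp (-m) * ((m * q : ℝ) ^ n / n.factorial))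
      (Real.exp (-m) * Real.exp (m * q)) := by
    have := NormedSpace.expSeries_div_hasSum_exp (𝔸 := ℝ) (m * q : ℝ)
    rw [← Real.exp_eq_exp_ℝ] at this
    exact this.mul_left _
  have hpos : ∀ n : ℕ, 0 ≤ Real.exp (-m) * ((m * q : ℝ) ^ n / n.factorial) := fun n => by positivity
  rw [lintegral_countable']
  calc ∑' n : ℕ, (q : ℝ≥0∞) ^ n * poissonMeasure m {n}
      = ∑' n : ℕ, ENNReal.ofReal (Real.exp (-m) * ((m * q : ℝ) ^ n / n.factorial)) := by
        refine tsum_congr fun n => ?_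
        rw [poissonMeasure_singleton, ← ENNReal.coe_pow, ← ENNReal.ofReal_coe_nnreal,
          ← ENNReal.ofReal_mul (by positivity)]
        congr 1
        push_cast
        ring
    _ = ENNReal.ofReal (Real.exp (-m) * Real.exp (m * q)) := by
        rw [← ENNReal.ofReal_tsum_of_nonneg hpos hs.summable, hs.tsum_eq]
    _ = negExp ((1 - q) * m) := by
        have : (1 - (q : ℝ≥0∞)) * m = ENNReal.ofReal ((1 - q) * m) := by
          rw [ENNReal.ofReal_mul (by linarith), ENNReal.ofReal_sub _ q.coe_nonneg]; simp
        rw [this, negExp_ofReal (mul_nonneg (by linarith) m.coe_nonneg), ← Real.exp_add]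
        congr 2
        ring

namespace IsPoissonProcess

variable {Ω E : Type*} [MeasurableSpace Ω] [MeasurableSpace E] {Λ : Measure E}
  {Φ : Ω → Measure E} {μ : Measure Ω}

lemma lintegral_negExp_mul_count [IsProbabilityMeasure μ] (h : IsPoissonProcess Λ Φ μ)
    {B : Set E} (hB : MeasurableSet B) (c : ℝ≥0∞) (hc : c = 0 ∨ Λ B ≠ ⊤) :
    ∫⁻ ω, negExp (c * Φ ω B) ∂μ = negExp ((1 - negExp c) * Λ B) := by
  rcases eq_or_ne c 0 with rfl | hc0
  · simp
  have hfin := hc.resolve_left hc0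
  have hm : Measurable fun x : ℝ≥0∞ => negExp (c * x) := by fun_prop
  rw [(h.count_law B hB hfin).lintegral_comp (f := fun x => negExp (c * x)) hm.aemeasurable,
    lintegral_map hm (measurable_of_countable _)]
  simp_rw [negExp_mul_natCast]
  rw [lintegral_poissonMeasure_pow _ (negExp_le_one c), ENNReal.coe_toNNReal hfin]

/-- The Laplace functional at a simple function of finite intensity. -/
lemma lintegral_negExp_simpleFunc [IsProbabilityMeasure μ] (h : IsPoissonProcess Λ Φ μ)
    (hΦ : Measurable Φ) (f : SimpleFunc E ℝ≥0∞) (hf : ∀ v, v ≠ 0 → Λ (f ⁻¹' {v}) ≠ ⊤) :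
    ∫⁻ ω, negExp (∫⁻ x, f x ∂(Φ ω)) ∂μ = negExp (∫⁻ x, (1 - negExp (f x)) ∂Λ) := by
  set n := f.range.card
  let e : Fin n → ℝ≥0∞ := fun i => (f.range.equivFin.symm i : ℝ≥0∞)
  have he : Function.Injective e := Subtype.val_injective.comp f.range.equivFin.symm.injective
  have hsum : ∀ g : ℝ≥0∞ → ℝ≥0∞, ∑ v ∈ f.range, g v = ∑ i : Fin n, g (e i) := fun g => by
    rw [← Finset.sum_coe_sort]
    exact (Equiv.sum_comp f.range.equivFin.symm fun v : f.range => g v).symm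
  have hmeas : ∀ i, MeasurableSet (f ⁻¹' {e i}) := fun i => f.measurableSet_preimage _
  -- The level sets of distinct values are disjoint, so their counts are independent and the Laplace
  -- transform factors.
  have hind := h.count_indep n (fun i => f ⁻¹' {e i}) hmeas fun i j hij =>
    Disjoint.preimage _ (by simpa using fun H => hij (he H))
  have hL : ∀ ω, negExp (∫⁻ x, f x ∂(Φ ω)) = ∏ i : Fin n, negExp (e i * Φ ω (f ⁻¹' {e i})) := by
    intro ω
    rw [SimpleFunc.lintegral_eq_lintegral, SimpleFunc.lintegral,
      hsum fun v => v * Φ ω (f ⁻¹' {v}), negExp_sum]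
  have hR : ∫⁻ x, (1 - negExp (f x)) ∂Λ = ∑ i : Fin n, (1 - negExp (e i)) * Λ (f ⁻¹' {e i}) := by
    have := SimpleFunc.lintegral_eq_lintegral (f.map fun v => 1 - negExp v) Λ
    rw [SimpleFunc.map_lintegral, hsum fun v => (1 - negExp v) * Λ (f ⁻¹' {v})] at this
    simpa using this
  simp_rw [hL, hR, negExp_sum]
  rw [lintegral_prod_eq_prod_lintegral_of_indepFun Finset.univ
    (fun i ω => negExp (e i * Φ ω (f ⁻¹' {e i})))
    (hind.comp (fun i x => negExp (e i * x)) fun i => by fun_prop) fun i => by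
      have := (Measure.measurable_coe (hmeas i)).comp hΦ
      exact measurable_negExp.comp (this.const_mul _)]
  refine Finset.prod_congr rfl fun i _ => h.lintegral_negExp_mul_count (hmeas i) _ ?_
  by_cases h0 : e i = 0
  · exact Or.inl h0
  · exact Or.inr (hf _ h0)

/-- The Laplace functional of a Poisson process. -/
theorem lintegral_negExp [IsProbabilityMeasure μ] [SigmaFinite Λ] (h : IsPoissonProcess Λ Φ μ)
    (hΦ : Measurable Φ) {f : E → ℝ≥0∞} (hf : Measurable f) :
    ∫⁻ ω, negExp (∫⁻ x, f x ∂(Φ ω)) ∂μ = negExp (∫⁻ x, (1 - negExp (f x)) ∂Λ) := by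
  classical
  -- Restricting to the spanning sets gives every nonzero level set finite intensity; on sets of
  -- infinite intensity the law of the count is not specified.
  let F : ℕ → SimpleFunc E ℝ≥0∞ := fun n =>
    (SimpleFunc.eapprox f n).restrict (spanningSets Λ n)
  have hFv : ∀ n x, F n x = (spanningSets Λ n).indicator (SimpleFunc.eapprox f n) x := fun n x =>
    SimpleFunc.restrict_apply _ (measurableSet_spanningSets Λ n) x
  have hmono : ∀ x, Monotone fun n => F n x := fun x m n hmn => by
    simp only [hFv]
    refine (indicator_le_indicator_of_subset (monotone_spanningSets Λ hmn) (fun _ => zero_le) x).trans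
      (indicator_le_indicator ?_)
    exact SimpleFunc.monotone_eapprox f hmn x
  have hlim : ∀ x, Tendsto (fun n => F n x) atTop (𝓝 (f x)) := fun x => by
    have h1 := SimpleFunc.tendsto_eapprox hf x
    refine h1.congr' ?_
    filter_upwards [eventually_ge_atTop (spanningSetsIndex Λ x)] with n hn
    rw [hFv, indicator_of_mem (mem_spanningSets_of_index_le Λ x hn)]
  have hfin : ∀ n v, v ≠ 0 → Λ (F n ⁻¹' {v}) ≠ ⊤ := fun n v hv => by
    refine ((measure_mono fun x hx => ?_).trans_lt (measure_spanningSets_lt_top Λ n)).ne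
    by_contra hxn
    have : F n x = 0 := by rw [hFv, indicator_of_notMem hxn]
    exact hv ((mem_singleton_iff.1 hx).symm.trans this)
  have hL : Tendsto (fun n => ∫⁻ ω, negExp (∫⁻ x, F n x ∂(Φ ω)) ∂μ) atTop
      (𝓝 (∫⁻ ω, negExp (∫⁻ x, f x ∂(Φ ω)) ∂μ)) := by
    refine tendsto_lintegral_of_dominated_convergence (fun _ => 1) (fun n => ?_)
      (fun n => Eventually.of_forall fun ω => negExp_le_one _) (by simp)
      (Eventually.of_forall fun ω => (continuous_negExp.tendsto _).comp ?_)
    · exact measurable_negExp.comp ((Measure.measurable_lintegral (F n).measurable).comp hΦ)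
    · exact lintegral_tendsto_of_tendsto_of_monotone (fun n => (F n).measurable.aemeasurable)
        (Eventually.of_forall hmono) (Eventually.of_forall hlim)
  have hR : Tendsto (fun n => negExp (∫⁻ x, (1 - negExp (F n x)) ∂Λ)) atTop
      (𝓝 (negExp (∫⁻ x, (1 - negExp (f x)) ∂Λ))) := by
    refine (continuous_negExp.tendsto _).comp (lintegral_tendsto_of_tendsto_of_monotone
      (fun n => ?_) (Eventually.of_forall fun x m n hmn => ?_) (Eventually.of_forall fun x => ?_))
    · exact (measurable_const.sub (measurable_negExp.comp (F n).measurable)).aemeasurable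
    · exact tsub_le_tsub_left (antitone_negExp (hmono x hmn)) _
    · exact ENNReal.Tendsto.sub tendsto_const_nhds ((continuous_negExp.tendsto _).comp (hlim x))
        (Or.inl ENNReal.one_ne_top)
  exact tendsto_nhds_unique hL
    (hR.congr fun n => (h.lintegral_negExp_simpleFunc hΦ (F n) (hfin n)).symm)

end IsPoissonProcess

/-! ### The Campbell–Mecke formula -/

lemma lintegral_sum_dirac {Ω E : Type*} [MeasurableSpace E] {X : ℕ → Ω → E} (ω : Ω) {f : E → ℝ≥0∞} (hf : Measurable f) :
    ∫⁻ x, f x ∂(Measure.sum fun k => Measure.dirac (X k ω)) = ∑' k, f (X k ω) := by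
  rw [lintegral_sum_measure]
  exact tsum_congr fun k => lintegral_dirac' _ hf

namespace IsPoissonProcess

section General

variable {Ω E : Type*} [MeasurableSpace Ω] [MeasurableSpace E] {Λ : Measure E}
  {Φ : Ω → Measure E} {μ : Measure Ω}

/-- The difference of the Laplace functionals at `f` and at `f + t 1_A`. Divided by `t`, it is the
difference quotient whose limit at `t = 0` gives Campbell–Mecke. -/
lemma lintegral_one_sub_negExp_mul_negExp [IsProbabilityMeasure μ] [SigmaFinite Λ]
    (h : IsPoissonProcess Λ Φ μ) (hΦ : Measurable Φ) {f : E → ℝ≥0∞} (hf : Measurable f)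
    {A : Set E} (hA : MeasurableSet A) (t : ℝ≥0∞) :
    ∫⁻ ω, (1 - negExp (t * Φ ω A)) * negExp (∫⁻ x, f x ∂(Φ ω)) ∂μ =
      negExp (∫⁻ x, (1 - negExp (f x)) ∂Λ) *
        (1 - negExp ((1 - negExp t) * ∫⁻ x in A, negExp (f x) ∂Λ)) := by
  have hft : Measurable fun x => f x + A.indicator (fun _ => t) x :=
    hf.add (measurable_const.indicator hA)
  have hF : Measurable fun ω => ∫⁻ x, f x ∂(Φ ω) := (Measure.measurable_lintegral hf).comp hΦ
  have hU : Measurable fun ω => Φ ω A := (Measure.measurable_coe hA).comp hΦ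
  have h1 := h.lintegral_negExp hΦ hft
  have hsplit : ∀ ω, ∫⁻ x, f x + A.indicator (fun _ => t) x ∂(Φ ω) =
      ∫⁻ x, f x ∂(Φ ω) + t * Φ ω A := fun ω => by
    rw [lintegral_add_left hf, lintegral_indicator_const hA]
  have hΛ : ∫⁻ x, (1 - negExp (f x + A.indicator (fun _ => t) x)) ∂Λ =
      ∫⁻ x, (1 - negExp (f x)) ∂Λ + (1 - negExp t) * ∫⁻ x in A, negExp (f x) ∂Λ := by
    have hnf : Measurable fun x => negExp (f x) := measurable_negExp.comp hf
    rw [← lintegral_const_mul _ hnf, ← lintegral_indicator hA,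
      ← lintegral_add_left (hnf.const_sub 1)]
    refine lintegral_congr fun x => ?_
    by_cases hx : x ∈ A
    · simp only [indicator_of_mem hx, negExp_add]
      rw [ENNReal.sub_mul fun _ _ => negExp_ne_top _, one_mul, mul_comm (negExp t)]
      exact (tsub_add_tsub_cancel (negExp_le_one _) (mul_le_of_le_one_right' (negExp_le_one _))).symm
    · simp [indicator_of_notMem hx]
  simp_rw [hsplit, hΛ, negExp_add] at h1
  have h2 : ∫⁻ ω, (1 - negExp (t * Φ ω A)) * negExp (∫⁻ x, f x ∂(Φ ω)) ∂μ =
      ∫⁻ ω, negExp (∫⁻ x, f x ∂(Φ ω)) ∂μ -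
        ∫⁻ ω, negExp (∫⁻ x, f x ∂(Φ ω)) * negExp (t * Φ ω A) ∂μ := by
    rw [← lintegral_sub (by fun_prop)]
    · refine lintegral_congr fun ω => ?_
      rw [ENNReal.sub_mul fun _ _ => negExp_ne_top _, one_mul, mul_comm (negExp (t * _))]
    · rw [h1]; exact ENNReal.mul_ne_top (negExp_ne_top _) (negExp_ne_top _)
    · exact Eventually.of_forall fun ω => mul_le_of_le_one_right' (negExp_le_one _)
  rw [h2, h1, h.lintegral_negExp hΦ hf, ENNReal.mul_sub fun _ _ => negExp_ne_top _, mul_one]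

lemma tendsto_lintegral_one_sub_negExp [IsProbabilityMeasure μ] [SigmaFinite Λ]
    (h : IsPoissonProcess Λ Φ μ) (hΦ : Measurable Φ) {f : E → ℝ≥0∞} (hf : Measurable f)
    {A : Set E} (hA : MeasurableSet A) (hfin : Λ A ≠ ⊤) :
    Tendsto (fun n : ℕ => ∫⁻ ω, (1 - negExp ((n + 1 : ℝ≥0∞)⁻¹ * Φ ω A)) * (n + 1) *
        negExp (∫⁻ x, f x ∂(Φ ω)) ∂μ) atTop
      (𝓝 (negExp (∫⁻ x, (1 - negExp (f x)) ∂Λ) * ∫⁻ x in A, negExp (f x) ∂Λ)) := by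
  have hκ : ∫⁻ x in A, negExp (f x) ∂Λ ≠ ⊤ := by
    refine ((lintegral_mono fun x => negExp_le_one (f x)).trans_lt ?_).ne
    simpa using hfin.lt_top
  refine (ENNReal.Tendsto.const_mul (tendsto_one_sub_negExp_one_sub_negExp_mul hκ)
    (Or.inr (negExp_ne_top _))).congr fun n => ?_
  rw [← mul_assoc, ← h.lintegral_one_sub_negExp_mul_negExp hΦ hf hA,
    ← lintegral_mul_const' _ _ (by finiteness)]
  exact lintegral_congr fun ω => mul_right_comm _ _ _

/-- Fatou's lemma for the difference quotients with `f = 0`. The resulting integrability of the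
count is the domination needed for general `f`. -/
lemma lintegral_count_le [IsProbabilityMeasure μ] [SigmaFinite Λ]
    (h : IsPoissonProcess Λ Φ μ) (hΦ : Measurable Φ) {A : Set E} (hA : MeasurableSet A)
    (hfin : Λ A ≠ ⊤) : ∫⁻ ω, Φ ω A ∂μ ≤ Λ A := by
  have hU : Measurable fun ω => Φ ω A := (Measure.measurable_coe hA).comp hΦ
  have h1 := h.tendsto_lintegral_one_sub_negExp hΦ (measurable_const (a := (0 : ℝ≥0∞))) hA hfin
  simp only [lintegral_zero, negExp_zero, tsub_self, mul_one, one_mul, lintegral_const,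
    Measure.restrict_apply_univ] at h1
  calc ∫⁻ ω, Φ ω A ∂μ
      = ∫⁻ ω, liminf (fun n : ℕ => (1 - negExp ((n + 1 : ℝ≥0∞)⁻¹ * Φ ω A)) * (n + 1)) atTop ∂μ :=
        lintegral_congr fun ω => (tendsto_one_sub_negExp_mul _).liminf_eq.symm
    _ ≤ liminf (fun n : ℕ => ∫⁻ ω, (1 - negExp ((n + 1 : ℝ≥0∞)⁻¹ * Φ ω A)) * (n + 1) ∂μ) atTop :=
        lintegral_liminf_le fun n => by fun_prop
    _ = Λ A := h1.liminf_eq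

/-- The derivative at `t = 0` of the Laplace functional at `f + t 1_A`, computed on both sides. The
difference quotients are dominated by the count because `1 - exp (-y) ≤ y`. -/
lemma lintegral_count_mul_negExp [IsProbabilityMeasure μ] [SigmaFinite Λ]
    (h : IsPoissonProcess Λ Φ μ) (hΦ : Measurable Φ) {f : E → ℝ≥0∞} (hf : Measurable f)
    {A : Set E} (hA : MeasurableSet A) (hfin : Λ A ≠ ⊤) :
    ∫⁻ ω, Φ ω A * negExp (∫⁻ x, f x ∂(Φ ω)) ∂μ =
      negExp (∫⁻ x, (1 - negExp (f x)) ∂Λ) * ∫⁻ x in A, negExp (f x) ∂Λ := by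
  have hU : Measurable fun ω => Φ ω A := (Measure.measurable_coe hA).comp hΦ
  have hF : Measurable fun ω => ∫⁻ x, f x ∂(Φ ω) := (Measure.measurable_lintegral hf).comp hΦ
  refine tendsto_nhds_unique ?_ (h.tendsto_lintegral_one_sub_negExp hΦ hf hA hfin)
  refine tendsto_lintegral_of_dominated_convergence (fun ω => Φ ω A) (fun n => by fun_prop)
    (fun n => Eventually.of_forall fun ω => ?_)
    ((h.lintegral_count_le hΦ hA hfin).trans_lt hfin.lt_top).ne
    (Eventually.of_forall fun ω => ENNReal.Tendsto.mul_const (tendsto_one_sub_negExp_mul _)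
      (Or.inr (negExp_ne_top _)))
  calc (1 - negExp ((n + 1 : ℝ≥0∞)⁻¹ * Φ ω A)) * (n + 1) * negExp (∫⁻ x, f x ∂(Φ ω))
      ≤ (n + 1 : ℝ≥0∞)⁻¹ * Φ ω A * (n + 1) * 1 := by
        gcongr
        · exact one_sub_negExp_le _
        · exact negExp_le_one _
    _ = ((n + 1 : ℝ≥0∞)⁻¹ * (n + 1)) * Φ ω A := by ring
    _ = Φ ω A := by rw [ENNReal.inv_mul_cancel (by simp) (by finiteness), one_mul]

end General

variable {Ω E : Type*} [MeasurableSpace Ω] [MeasurableSpace E] {Λ : Measure E}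
  {μ : Measure Ω} {X : ℕ → Ω → E}

lemma measurable_sum_dirac (hX : ∀ k, Measurable (X k)) :
    Measurable fun ω => Measure.sum fun k => Measure.dirac (X k ω) := by
  refine Measure.measurable_of_measurable_coe _ fun s hs => ?_
  simp_rw [Measure.sum_apply _ hs]
  exact Measurable.tsum fun k => (Measure.measurable_coe hs).comp
    (Measure.measurable_dirac.comp (hX k))

/-- The Campbell–Mecke formula for the exponential functional of the whole process. -/
lemma tsum_lintegral_mul_negExp [IsProbabilityMeasure μ] [SigmaFinite Λ]
    (hX : ∀ k, Measurable (X k))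
    (h : IsPoissonProcess Λ (fun ω => Measure.sum fun k => Measure.dirac (X k ω)) μ)
    {f w : E → ℝ≥0∞} (hf : Measurable f) (hw : Measurable w) :
    ∑' k, ∫⁻ ω, w (X k ω) * negExp (∑' j, f (X j ω)) ∂μ =
      negExp (∫⁻ x, (1 - negExp (f x)) ∂Λ) * ∫⁻ x, w x * negExp (f x) ∂Λ := by
  have hΦ := measurable_sum_dirac hX
  have hF : Measurable fun ω => negExp (∑' j, f (X j ω)) :=
    measurable_negExp.comp (Measurable.tsum fun j => hf.comp (hX j))
  let c := negExp (∫⁻ x, (1 - negExp (f x)) ∂Λ)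
  -- As functions of the weight, both sides are integrals against a measure. The two measures agree
  -- on sets of finite intensity, hence everywhere by exhaustion, and so for every weight.
  let M : Measure E := Measure.sum fun k =>
    (μ.withDensity fun ω => negExp (∑' j, f (X j ω))).map (X k)
  have hM : ∀ g : E → ℝ≥0∞, Measurable g →
      ∫⁻ x, g x ∂M = ∑' k, ∫⁻ ω, g (X k ω) * negExp (∑' j, f (X j ω)) ∂μ := fun g hg => by
    rw [lintegral_sum_measure]
    refine tsum_congr fun k => ?_
    have hgX : Measurable fun ω => g (X k ω) := hg.comp (hX k)
    rw [lintegral_map hg (hX k), lintegral_withDensity_eq_lintegral_mul _ hF hgX]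
    exact lintegral_congr fun ω => mul_comm _ _
  have hfin : ∀ A, MeasurableSet A → Λ A ≠ ⊤ →
      M A = (c • Λ.withDensity fun x => negExp (f x)) A := fun A hA hA' => by
    have h1 := h.lintegral_count_mul_negExp hΦ hf hA hA'
    have hk : ∀ k, Measurable fun ω => A.indicator (1 : E → ℝ≥0∞) (X k ω) *
        negExp (∑' j, f (X j ω)) := fun k => ((measurable_one.indicator hA).comp (hX k)).mul hF
    rw [Measure.smul_apply, withDensity_apply _ hA, smul_eq_mul, ← h1, ← lintegral_indicator_one hA,
      hM _ (measurable_one.indicator hA), ← lintegral_tsum fun k => (hk k).aemeasurable]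
    refine lintegral_congr fun ω => ?_
    rw [ENNReal.tsum_mul_right, lintegral_sum_dirac ω hf, ← lintegral_indicator_one hA,
      lintegral_sum_dirac ω (measurable_one.indicator hA)]
  have hMΛ : M = c • Λ.withDensity fun x => negExp (f x) := by
    refine Measure.ext fun A hA => ?_
    have hmono : Monotone fun n => A ∩ spanningSets Λ n := fun m n hmn =>
      inter_subset_inter_right _ (monotone_spanningSets Λ hmn)
    have hU : A = ⋃ n, A ∩ spanningSets Λ n := by
      rw [← inter_iUnion, iUnion_spanningSets, inter_univ]
    rw [hU, hmono.measure_iUnion, hmono.measure_iUnion]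
    exact iSup_congr fun n => hfin _ (hA.inter (measurableSet_spanningSets Λ n))
      ((measure_mono inter_subset_right).trans_lt (measure_spanningSets_lt_top Λ n)).ne
  have hnf : Measurable fun x => negExp (f x) := measurable_negExp.comp hf
  rw [← hM w hw, hMΛ, lintegral_smul_measure, smul_eq_mul,
    lintegral_withDensity_eq_lintegral_mul _ hnf hw]
  congr 1
  exact lintegral_congr fun x => mul_comm _ _

/-- Campbell's formula. -/
lemma tsum_lintegral [IsProbabilityMeasure μ] [SigmaFinite Λ] (hX : ∀ k, Measurable (X k))
    (h : IsPoissonProcess Λ (fun ω => Measure.sum fun k => Measure.dirac (X k ω)) μ)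
    {w : E → ℝ≥0∞} (hw : Measurable w) :
    ∑' k, ∫⁻ ω, w (X k ω) ∂μ = ∫⁻ x, w x ∂Λ := by
  simpa using h.tsum_lintegral_mul_negExp hX (measurable_const (a := (0 : ℝ≥0∞))) hw

/-- The Campbell–Mecke formula for the exponential functional of the reduced process. -/
lemma tsum_lintegral_mul_negExp_ne [IsProbabilityMeasure μ] [SigmaFinite Λ]
    (hX : ∀ k, Measurable (X k))
    (h : IsPoissonProcess Λ (fun ω => Measure.sum fun k => Measure.dirac (X k ω)) μ)
    {f w : E → ℝ≥0∞} (hf : Measurable f) (hfin : ∀ x, f x ≠ ⊤) (hw : Measurable w) :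
    ∑' k, ∫⁻ ω, w (X k ω) * negExp (∑' j, if j = k then 0 else f (X j ω)) ∂μ =
      negExp (∫⁻ x, (1 - negExp (f x)) ∂Λ) * ∫⁻ x, w x ∂Λ := by
  -- Dividing the weight by `negExp (f x)` removes the distinguished point's own contribution to the
  -- sum. This is where `f` must be finite.
  have h1 := h.tsum_lintegral_mul_negExp hX hf
    (w := fun x => w x * (negExp (f x))⁻¹) (hw.mul (measurable_negExp.comp hf).inv)
  have hinv : ∀ x, (negExp (f x))⁻¹ * negExp (f x) = 1 := fun x =>
    ENNReal.inv_mul_cancel (negExp_ne_zero (hfin x)) (negExp_ne_top _)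
  simp_rw [mul_assoc, hinv, mul_one] at h1
  rw [← h1]
  refine tsum_congr fun k => lintegral_congr fun ω => ?_
  rw [ENNReal.tsum_eq_add_tsum_ite (f := fun j => f (X j ω)) k, negExp_add, ← mul_assoc (negExp _)⁻¹, hinv, one_mul]
  congr!

/-- The Campbell–Mecke formula for an exponential functional of the reduced process that depends on
a countably valued mark of the distinguished point. -/
lemma tsum_lintegral_mul_negExp_mark [IsProbabilityMeasure μ] [SigmaFinite Λ]
    (hX : ∀ k, Measurable (X k))
    (h : IsPoissonProcess Λ (fun ω => Measure.sum fun k => Measure.dirac (X k ω)) μ)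
    {π : E → ℕ} (hπ : Measurable π) {f : ℕ → E → ℝ≥0∞} (hf : ∀ v, Measurable (f v))
    (hfin : ∀ v x, f v x ≠ ⊤) {w : E → ℝ≥0∞} (hw : Measurable w) :
    ∑' k, ∫⁻ ω, w (X k ω) * negExp (∑' j, if j = k then 0 else f (π (X k ω)) (X j ω)) ∂μ =
      ∫⁻ x, w x * negExp (∫⁻ y, (1 - negExp (f (π x) y)) ∂Λ) ∂Λ := by
  have hcell : ∀ v, MeasurableSet (π ⁻¹' {v}) := fun v => hπ (measurableSet_singleton v)
  -- The weight is split over the cells of the mark. On each cell the functional no longer depends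
  -- on the distinguished point.
  have hdec : ∀ (g : ℕ → ℝ≥0∞) (x : E), w x * g (π x) =
      ∑' v, (π ⁻¹' {v}).indicator w x * g v := fun g x => by
    rw [tsum_eq_single (π x) fun v hv => by
      rw [indicator_of_notMem (by simpa using hv.symm), zero_mul]]
    simp
  have hterm : ∀ v k, Measurable fun ω => (π ⁻¹' {v}).indicator w (X k ω) *
      negExp (∑' j, if j = k then 0 else f v (X j ω)) := fun v k => by
    refine ((hw.indicator (hcell v)).comp (hX k)).mul (measurable_negExp.comp
      (Measurable.tsum fun j => ?_))
    split_ifs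
    · exact measurable_const
    · exact (hf v).comp (hX j)
  calc ∑' k, ∫⁻ ω, w (X k ω) * negExp (∑' j, if j = k then 0 else f (π (X k ω)) (X j ω)) ∂μ
      = ∑' k, ∑' v, ∫⁻ ω, (π ⁻¹' {v}).indicator w (X k ω) *
          negExp (∑' j, if j = k then 0 else f v (X j ω)) ∂μ := by
        refine tsum_congr fun k => ?_
        rw [← lintegral_tsum fun v => (hterm v k).aemeasurable]
        exact lintegral_congr fun ω =>
          hdec (fun v => negExp (∑' j, if j = k then 0 else f v (X j ω))) (X k ω)
    _ = ∑' v, negExp (∫⁻ y, (1 - negExp (f v y)) ∂Λ) * ∫⁻ x, (π ⁻¹' {v}).indicator w x ∂Λ := by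
        rw [ENNReal.tsum_comm]
        exact tsum_congr fun v =>
          h.tsum_lintegral_mul_negExp_ne hX (hf v) (hfin v) (hw.indicator (hcell v))
    _ = ∫⁻ x, ∑' v, (π ⁻¹' {v}).indicator w x * negExp (∫⁻ y, (1 - negExp (f v y)) ∂Λ) ∂Λ := by
        rw [lintegral_tsum fun v => ((hw.indicator (hcell v)).mul_const _).aemeasurable]
        refine tsum_congr fun v => ?_
        rw [lintegral_mul_const _ (hw.indicator (hcell v)), mul_comm]
    _ = ∫⁻ x, w x * negExp (∫⁻ y, (1 - negExp (f (π x) y)) ∂Λ) ∂Λ :=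
        lintegral_congr fun x => (hdec (fun v => negExp (∫⁻ y, (1 - negExp (f v y)) ∂Λ)) x).symm

end IsPoissonProcess

/-! ### Finiteness of sums, distinct levels, and functionals depending on the level -/

/-- Dominated convergence for series in `[0, ∞]`. -/
lemma ENNReal.tendsto_tsum_of_dominated {f : ℕ → ℕ → ℝ≥0∞} {g bound : ℕ → ℝ≥0∞}
    (hle : ∀ n k, f n k ≤ bound k) (hfin : ∑' k, bound k ≠ ⊤)
    (hlim : ∀ k, Tendsto (fun n => f n k) atTop (𝓝 (g k))) :
    Tendsto (fun n => ∑' k, f n k) atTop (𝓝 (∑' k, g k)) := by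
  simp_rw [← lintegral_count] at hfin ⊢
  exact tendsto_lintegral_of_dominated_convergence bound (fun n => measurable_of_countable _)
    (fun n => Eventually.of_forall (hle n)) hfin (Eventually.of_forall hlim)

section DyadicFloor

lemma dyadicFloor_le {a : ℝ} (ha : 0 ≤ a) (n : ℕ) : (⌊a * 2 ^ n⌋₊ : ℝ) / 2 ^ n ≤ a := by
  rw [div_le_iff₀ (by positivity)]
  exact Nat.floor_le (by positivity)

lemma monotone_dyadicFloor {a : ℝ} (ha : 0 ≤ a) :
    Monotone fun n : ℕ => (⌊a * 2 ^ n⌋₊ : ℝ) / 2 ^ n := by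
  refine monotone_nat_of_le_succ fun n => ?_
  rw [div_le_div_iff₀ (by positivity) (by positivity)]
  have h : (⌊a * 2 ^ n⌋₊ * 2 : ℕ) ≤ ⌊a * 2 ^ (n + 1)⌋₊ := by
    refine Nat.le_floor ?_
    push_cast
    rw [pow_succ, ← mul_assoc]
    exact mul_le_mul_of_nonneg_right (Nat.floor_le (by positivity)) zero_le_two
  have h' : (⌊a * 2 ^ n⌋₊ : ℝ) * 2 ≤ ⌊a * 2 ^ (n + 1)⌋₊ := by exact_mod_cast h
  generalize (⌊a * 2 ^ (n + 1)⌋₊ : ℝ) = q at h' ⊢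
  rw [pow_succ]
  nlinarith [pow_pos (zero_lt_two (α := ℝ)) n]

lemma tendsto_dyadicFloor {a : ℝ} (ha : 0 ≤ a) :
    Tendsto (fun n : ℕ => (⌊a * 2 ^ n⌋₊ : ℝ) / 2 ^ n) atTop (𝓝 a) :=
  (tendsto_nat_floor_mul_div_atTop ha).comp (tendsto_pow_atTop_atTop_of_one_lt one_lt_two)

end DyadicFloor

namespace IsPoissonProcess

variable {Ω E : Type*} [MeasurableSpace Ω] [MeasurableSpace E] {Λ : Measure E}
  {μ : Measure Ω} {X : ℕ → Ω → E}

/-- Almost surely only finitely many points lie in `A`, each with a finite value; the sum over the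
other points has finite mean by Campbell's formula. So `w` may have a non-integrable singularity
inside `A`. -/
lemma ae_tsum_ne_top [IsProbabilityMeasure μ] [SigmaFinite Λ] (hX : ∀ k, Measurable (X k))
    (h : IsPoissonProcess Λ (fun ω => Measure.sum fun k => Measure.dirac (X k ω)) μ)
    {w : E → ℝ≥0∞} (hw : Measurable w) (hwt : ∀ x, w x ≠ ⊤) {A : Set E} (hA : MeasurableSet A)
    (hAfin : Λ A ≠ ⊤) (hAc : ∫⁻ x in Aᶜ, w x ∂Λ ≠ ⊤) :
    ∀ᵐ ω ∂μ, ∑' k, w (X k ω) ≠ ⊤ := by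
  have key : ∀ g : E → ℝ≥0∞, Measurable g → ∫⁻ x, g x ∂Λ ≠ ⊤ →
      ∀ᵐ ω ∂μ, ∑' k, g (X k ω) < ⊤ := fun g hg hfin => by
    have hgX : ∀ k, Measurable fun ω => g (X k ω) := fun k => hg.comp (hX k)
    refine ae_lt_top (Measurable.tsum hgX) ?_
    rw [lintegral_tsum fun k => (hgX k).aemeasurable]
    exact (h.tsum_lintegral hX hg).trans_ne hfin
  filter_upwards [key (A.indicator 1) (measurable_one.indicator hA)
      (by rwa [lintegral_indicator_one hA]),
    key (Aᶜ.indicator w) (hw.indicator hA.compl) (by rwa [lintegral_indicator hA.compl])]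
    with ω h1 h2
  have hfinite : {k | X k ω ∈ A}.Finite := by
    refine (ENNReal.finite_const_le_of_tsum_ne_top h1.ne one_ne_zero).subset fun k hk => ?_
    have hk' : X k ω ∈ A := hk
    simp [hk']
  have hsplit : ∀ k, w (X k ω) = A.indicator w (X k ω) + Aᶜ.indicator w (X k ω) := fun k => by
    by_cases hk : X k ω ∈ A <;> simp [hk]
  simp_rw [hsplit]
  rw [ENNReal.tsum_add]
  refine ENNReal.add_ne_top.2 ⟨?_, h2.ne⟩
  rw [tsum_eq_sum (s := hfinite.toFinset) fun k hk => by
    rw [indicator_of_notMem (by simpa using hk)]]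
  refine ENNReal.sum_ne_top.2 fun k hk => ?_
  rw [indicator_of_mem (by simpa using hk)]
  exact hwt _

/-- A Poisson process whose intensity does not charge the level sets of `ρ` has no two points at
the same level. -/
lemma ae_forall_ne [IsProbabilityMeasure μ] [SigmaFinite Λ] (hX : ∀ k, Measurable (X k))
    (h : IsPoissonProcess Λ (fun ω => Measure.sum fun k => Measure.dirac (X k ω)) μ)
    {ρ : E → ℝ} (hρ : Measurable ρ) (hρ0 : ∀ x, 0 ≤ ρ x) (hnull : ∀ a, Λ {y | ρ y = a} = 0)
    (hfin : ∀ R, Λ {y | ρ y ≤ R} ≠ ⊤) :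
    ∀ᵐ ω ∂μ, ∀ k j, j ≠ k → ρ (X j ω) ≠ ρ (X k ω) := by
  classical
  -- Levels are rounded down to multiples of `1 / (n + 1)`, which gives a countable mark. Below, `c
  -- n v` indicates the cell of index `v`, and `g k` counts the other points exactly level with the
  -- `k`-th one.
  let π : ℕ → E → ℕ := fun n x => ⌊ρ x * (n + 1)⌋₊
  have hπ : ∀ n, Measurable (π n) := fun n => Nat.measurable_floor.comp (hρ.mul_const _)
  let c : ℕ → ℕ → E → ℝ≥0∞ := fun n v y => if π n y = v then 1 else 0
  have hc : ∀ n v, Measurable (c n v) := fun n v =>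
    Measurable.ite (hπ n (measurableSet_singleton v)) measurable_const measurable_const
  let g : ℕ → Ω → ℝ≥0∞ := fun k ω =>
    ∑' j, if j = k then 0 else if ρ (X j ω) = ρ (X k ω) then 1 else 0
  have hg : ∀ k, Measurable (g k) := fun k => by
    refine Measurable.tsum fun j => ?_
    split_ifs
    · exact measurable_const
    · exact Measurable.ite (measurableSet_eq_fun (hρ.comp (hX j)) (hρ.comp (hX k)))
        measurable_const measurable_const
  have hcell : ∀ x, Tendsto (fun n => Λ {y | π n y = π n x}) atTop (𝓝 0) := fun x => by
    let S : ℕ → Set E := fun n => {y | |ρ y - ρ x| ≤ 1 / ((n : ℝ) + 1)}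
    have hSm : ∀ n, MeasurableSet (S n) := fun n =>
      measurableSet_le ((hρ.sub_const _).abs) measurable_const
    have hS : Antitone S := fun m n hmn y hy => by
      have hy' : |ρ y - ρ x| ≤ 1 / ((n : ℝ) + 1) := hy
      exact hy'.trans (Nat.one_div_le_one_div hmn)
    have hlim := tendsto_measure_iInter_atTop (μ := Λ) (fun n => (hSm n).nullMeasurableSet) hS
      ⟨0, ((measure_mono fun y hy => by
        have hy' : |ρ y - ρ x| ≤ 1 / (((0 : ℕ) : ℝ) + 1) := hy
        have := (abs_le.1 hy').2
        simp only [CharP.cast_eq_zero, zero_add, div_one] at this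
        show ρ y ≤ ρ x + 1
        linarith).trans_lt (hfin (ρ x + 1)).lt_top).ne⟩
    have hI : ⋂ n, S n = {y | ρ y = ρ x} := by
      ext y
      simp only [mem_iInter, mem_ofPred_eq, S]
      constructor
      · intro hy
        have : |ρ y - ρ x| ≤ 0 := ge_of_tendsto' tendsto_one_div_add_atTop_nhds_zero_nat hy
        linarith [abs_nonpos_iff.1 this]
      · intro hy n
        rw [hy, sub_self, abs_zero]; positivity
    rw [hI, hnull] at hlim
    refine tendsto_of_tendsto_of_tendsto_of_le_of_le tendsto_const_nhds hlim (fun _ => zero_le)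
      fun n => measure_mono fun y hy => ?_
    have hy' : ⌊ρ y * ((n : ℝ) + 1)⌋₊ = ⌊ρ x * ((n : ℝ) + 1)⌋₊ := hy
    have hn : (0 : ℝ) < n + 1 := by positivity
    have h1 := Nat.floor_le (mul_nonneg (hρ0 y) hn.le)
    have h2 := Nat.lt_floor_add_one (ρ y * ((n : ℝ) + 1))
    have h3 := Nat.floor_le (mul_nonneg (hρ0 x) hn.le)
    have h4 := Nat.lt_floor_add_one (ρ x * ((n : ℝ) + 1))
    rw [hy'] at h1 h2
    show |ρ y - ρ x| ≤ 1 / ((n : ℝ) + 1)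
    have h5 : |(ρ y - ρ x) * ((n : ℝ) + 1)| ≤ 1 := by
      rw [sub_mul, abs_le]
      constructor <;> linarith
    rwa [abs_mul, abs_of_pos hn, ← le_div_iff₀ hn] at h5
  have main : ∀ R : ℕ, ∀ k, ∀ᵐ ω ∂μ, ρ (X k ω) ≤ R → g k ω = 0 := fun R => by
    let w : E → ℝ≥0∞ := {y | ρ y ≤ R}.indicator 1
    have hRm : MeasurableSet {y | ρ y ≤ R} := measurableSet_le hρ measurable_const
    have hw : Measurable w := measurable_one.indicator hRm
    have hwfin : ∫⁻ x, w x ∂Λ ≠ ⊤ := by rw [lintegral_indicator_one hRm]; exact hfin R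
    -- Points at the same level share a cell, so cell counts dominate `g`. Campbell–Mecke for the
    -- cells gives the lower bound, since the intensity of a cell tends to `0`. Campbell's formula
    -- gives the same value without the factor `negExp (g k ω)`, which must therefore be `1`
    -- wherever `w` is nonzero.
    have hge : ∫⁻ x, w x ∂Λ ≤ ∑' k, ∫⁻ ω, w (X k ω) * negExp (g k ω) ∂μ := by
      have hmeas : ∀ n, Measurable fun x => Λ {y | π n y = π n x} := fun n =>
        (measurable_of_countable fun v : ℕ => Λ {y | π n y = v}).comp (hπ n)
      have hT : Tendsto (fun n => ∫⁻ x, w x * negExp (Λ {y | π n y = π n x}) ∂Λ) atTop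
          (𝓝 (∫⁻ x, w x ∂Λ)) := by
        refine tendsto_lintegral_of_dominated_convergence w
          (fun n => hw.mul (measurable_negExp.comp (hmeas n)))
          (fun n => Eventually.of_forall fun x => mul_le_of_le_one_right' (negExp_le_one _)) hwfin
          (Eventually.of_forall fun x => ?_)
        have := ENNReal.Tendsto.const_mul (a := w x)
          ((continuous_negExp.tendsto _).comp (hcell x)) (Or.inl (by simp))
        simpa using this
      refine le_of_tendsto' hT fun n => ?_
      calc ∫⁻ x, w x * negExp (Λ {y | π n y = π n x}) ∂Λ
          ≤ ∫⁻ x, w x * negExp (∫⁻ y, (1 - negExp (c n (π n x) y)) ∂Λ) ∂Λ := by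
            refine lintegral_mono fun x => mul_le_mul_right (antitone_negExp ?_) _
            calc ∫⁻ y, (1 - negExp (c n (π n x) y)) ∂Λ
                ≤ ∫⁻ y, {y | π n y = π n x}.indicator 1 y ∂Λ :=
                  lintegral_mono fun y => by
                    refine (one_sub_negExp_le _).trans (le_of_eq ?_)
                    simp [c, indicator_apply]
              _ = Λ {y | π n y = π n x} :=
                  lintegral_indicator_one (hπ n (measurableSet_singleton _))
        _ = ∑' k, ∫⁻ ω, w (X k ω) *
              negExp (∑' j, if j = k then 0 else c n (π n (X k ω)) (X j ω)) ∂μ :=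
            (h.tsum_lintegral_mul_negExp_mark hX (hπ n) (hc n)
              (fun v x => by simp only [c]; split_ifs <;> simp) hw).symm
        _ ≤ ∑' k, ∫⁻ ω, w (X k ω) * negExp (g k ω) ∂μ := by
            refine ENNReal.tsum_le_tsum fun k => lintegral_mono fun ω =>
              mul_le_mul_right (antitone_negExp (ENNReal.tsum_le_tsum fun j => ?_)) _
            split_ifs with h1 h2
            · exact le_rfl
            · simp [c, π, h2]
            · exact zero_le
    have hsum : ∑' k, ∫⁻ ω, w (X k ω) * negExp (g k ω) ∂μ +
        ∑' k, ∫⁻ ω, w (X k ω) * (1 - negExp (g k ω)) ∂μ = ∫⁻ x, w x ∂Λ := by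
      rw [← ENNReal.tsum_add, ← h.tsum_lintegral hX hw]
      refine tsum_congr fun k => ?_
      have hwk : Measurable fun ω => w (X k ω) := hw.comp (hX k)
      have hgk := hg k
      rw [← lintegral_add_left (by fun_prop)]
      refine lintegral_congr fun ω => ?_
      rw [← mul_add, add_tsub_cancel_of_le (negExp_le_one _), mul_one]
    have hzero : ∑' k, ∫⁻ ω, w (X k ω) * (1 - negExp (g k ω)) ∂μ = 0 := by
      have hle : ∑' k, ∫⁻ ω, w (X k ω) * negExp (g k ω) ∂μ ≠ ⊤ :=
        (le_self_add.trans_lt (hsum.trans_lt hwfin.lt_top)).ne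
      rw [← hsum] at hge
      have := ENNReal.le_of_add_le_add_left hle (hge.trans (add_zero _).ge)
      exact le_antisymm this zero_le
    intro k
    have hwk : Measurable fun ω => w (X k ω) := hw.comp (hX k)
    have hgk := hg k
    have := (ENNReal.tsum_eq_zero.1 hzero) k
    rw [lintegral_eq_zero_iff (by fun_prop)] at this
    filter_upwards [this] with ω hω hR
    have hw1 : w (X k ω) = 1 := indicator_of_mem (by exact hR) _
    simp only [hw1, one_mul, Pi.zero_apply, tsub_eq_zero_iff_le] at hω
    by_contra hne
    rcases eq_or_ne (g k ω) ⊤ with ht | ht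
    · simp [ht] at hω
    · rw [negExp_eq_ofReal ht, ENNReal.one_le_ofReal, Real.one_le_exp_iff] at hω
      have := ENNReal.toReal_pos hne ht
      linarith
  have hall : ∀ᵐ ω ∂μ, ∀ R : ℕ, ∀ k, ρ (X k ω) ≤ R → g k ω = 0 :=
    ae_all_iff.2 fun R => ae_all_iff.2 fun k => main R k
  filter_upwards [hall] with ω hω k j hjk heq
  obtain ⟨R, hR⟩ := exists_nat_ge (ρ (X k ω))
  have := (ENNReal.tsum_eq_zero.1 (hω R k hR)) j
  simp [hjk, heq] at this

/-- The level is rounded down to dyadic multiples, which reduces to a countable mark. The roundings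
increase to the level, so monotonicity and left continuity of `f` allow passage to the limit on both
sides; the integrable weight dominates. -/
lemma tsum_lintegral_mul_negExp_mono_of_lintegral_ne_top [IsProbabilityMeasure μ] [SigmaFinite Λ]
    (hX : ∀ k, Measurable (X k))
    (h : IsPoissonProcess Λ (fun ω => Measure.sum fun k => Measure.dirac (X k ω)) μ)
    {ρ : E → ℝ} (hρ : Measurable ρ) (hρ0 : ∀ x, 0 ≤ ρ x) {f : ℝ → E → ℝ≥0∞}
    (hf : ∀ a, Measurable (f a)) (hmono : ∀ y, MonotoneOn (fun a => f a y) (Ici 0))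
    (hcont : ∀ y a, 0 ≤ a → ContinuousWithinAt (fun b => f b y) (Icc 0 a) a)
    {w : E → ℝ≥0∞} (hw : Measurable w) (hwfin : ∫⁻ x, w x ∂Λ ≠ ⊤) :
    ∑' k, ∫⁻ ω, w (X k ω) * negExp (∑' j, if j = k then 0 else f (ρ (X k ω)) (X j ω)) ∂μ =
      ∫⁻ x, w x * negExp (∫⁻ y, (1 - negExp (f (ρ x) y)) ∂Λ) ∂Λ := by
  let π : ℕ → E → ℕ := fun n x => ⌊ρ x * 2 ^ n⌋₊
  have hπ : ∀ n, Measurable (π n) := fun n => Nat.measurable_floor.comp (hρ.mul_const _)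
  -- The truncation at `n` is needed because the marked formula requires finite functions, whereas a
  -- station cost is infinite at nearer points when `p = 1`.
  let F : ℕ → ℕ → E → ℝ≥0∞ := fun n v y => min (f ((v : ℝ) / 2 ^ n) y) n
  have hF : ∀ n v, Measurable (F n v) := fun n v => (hf _).min measurable_const
  have hFx : ∀ x y, Monotone fun n => F n (π n x) y := fun x y m n hmn =>
    min_le_min (hmono y (mem_Ici.2 (by positivity)) (mem_Ici.2 (by positivity))
      (monotone_dyadicFloor (hρ0 x) hmn)) (by exact_mod_cast hmn)
  have hFlim : ∀ x y, Tendsto (fun n => F n (π n x) y) atTop (𝓝 (f (ρ x) y)) := fun x y => by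
    have h1 : Tendsto (fun n => f ((π n x : ℝ) / 2 ^ n) y) atTop (𝓝 (f (ρ x) y)) :=
      (hcont y (ρ x) (hρ0 x)).tendsto.comp (tendsto_nhdsWithin_iff.2
        ⟨tendsto_dyadicFloor (hρ0 x), Eventually.of_forall fun n =>
          ⟨by positivity, dyadicFloor_le (hρ0 x) n⟩⟩)
    simpa using h1.min ENNReal.tendsto_nat_nhds_top
  have hFfin : ∀ n v x, F n v x ≠ ⊤ := fun n v x =>
    ((min_le_right _ _).trans_lt (ENNReal.natCast_lt_top n)).ne
  clear_value F π
  have hterm : ∀ n k, Measurable fun ω => w (X k ω) *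
      negExp (∑' j, if j = k then 0 else F n (π n (X k ω)) (X j ω)) := fun n k => by
    refine (hw.comp (hX k)).mul (measurable_negExp.comp (Measurable.tsum fun j => ?_))
    split_ifs
    · exact measurable_const
    · have : Measurable fun p : ℕ × E => F n p.1 p.2 := measurable_from_prod_countable_right (hF n)
      exact this.comp (((hπ n).comp (hX k)).prodMk (hX j))
  have hL : Tendsto (fun n => ∑' k, ∫⁻ ω, w (X k ω) *
        negExp (∑' j, if j = k then 0 else F n (π n (X k ω)) (X j ω)) ∂μ) atTop
      (𝓝 (∑' k, ∫⁻ ω, w (X k ω) *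
        negExp (∑' j, if j = k then 0 else f (ρ (X k ω)) (X j ω)) ∂μ)) := by
    have hcamp : ∑' k, ∫⁻ ω, w (X k ω) ∂μ ≠ ⊤ := (h.tsum_lintegral hX hw).trans_ne hwfin
    refine ENNReal.tendsto_tsum_of_dominated (bound := fun k => ∫⁻ ω, w (X k ω) ∂μ)
      (fun n k => lintegral_mono fun ω => mul_le_of_le_one_right' (negExp_le_one _)) hcamp
      fun k => ?_
    have hwk : ∫⁻ ω, w (X k ω) ∂μ ≠ ⊤ := ENNReal.ne_top_of_tsum_ne_top hcamp k
    refine tendsto_lintegral_of_dominated_convergence (fun ω => w (X k ω)) (fun n => hterm n k)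
      (fun n => Eventually.of_forall fun ω => mul_le_of_le_one_right' (negExp_le_one _)) hwk ?_
    filter_upwards [ae_lt_top (hw.comp (hX k)) hwk] with ω hω
    refine ENNReal.Tendsto.const_mul ((continuous_negExp.tendsto _).comp ?_) (Or.inr hω.ne)
    simp_rw [← lintegral_count]
    refine lintegral_tendsto_of_tendsto_of_monotone
      (fun n => (measurable_of_countable _).aemeasurable)
      (Eventually.of_forall fun j m n hmn => ?_) (Eventually.of_forall fun j => ?_)
    · dsimp only
      split_ifs
      · exact le_rfl
      · exact hFx _ _ hmn
    · split_ifs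
      · exact tendsto_const_nhds
      · exact hFlim _ _
  have hR : Tendsto (fun n => ∫⁻ x, w x * negExp (∫⁻ y, (1 - negExp (F n (π n x) y)) ∂Λ) ∂Λ) atTop
      (𝓝 (∫⁻ x, w x * negExp (∫⁻ y, (1 - negExp (f (ρ x) y)) ∂Λ) ∂Λ)) := by
    refine tendsto_lintegral_of_dominated_convergence w (fun n => hw.mul (measurable_negExp.comp
        ((measurable_of_countable fun v => ∫⁻ y, (1 - negExp (F n v y)) ∂Λ).comp (hπ n))))
      (fun n => Eventually.of_forall fun x => mul_le_of_le_one_right' (negExp_le_one _)) hwfin ?_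
    filter_upwards [ae_lt_top hw hwfin] with x hx
    refine ENNReal.Tendsto.const_mul ((continuous_negExp.tendsto _).comp ?_) (Or.inr hx.ne)
    refine lintegral_tendsto_of_tendsto_of_monotone
      (fun n => ((measurable_negExp.comp (hF n (π n x))).const_sub 1).aemeasurable)
      (Eventually.of_forall fun y m n hmn => ?_) (Eventually.of_forall fun y => ?_)
    · exact tsub_le_tsub_left (antitone_negExp (hFx x y hmn)) _
    · exact ENNReal.Tendsto.sub tendsto_const_nhds
        ((continuous_negExp.tendsto _).comp (hFlim x y)) (Or.inl ENNReal.one_ne_top)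
  exact tendsto_nhds_unique hL (hR.congr fun n =>
    (h.tsum_lintegral_mul_negExp_mark hX (hπ n) (hF n)
      (hFfin n) hw).symm)

/-- The Campbell–Mecke formula for an exponential functional of the reduced process that depends
in a monotone way on the level `ρ` of the distinguished point. -/
theorem tsum_lintegral_mul_negExp_mono [IsProbabilityMeasure μ] [SigmaFinite Λ]
    (hX : ∀ k, Measurable (X k))
    (h : IsPoissonProcess Λ (fun ω => Measure.sum fun k => Measure.dirac (X k ω)) μ)
    {ρ : E → ℝ} (hρ : Measurable ρ) (hρ0 : ∀ x, 0 ≤ ρ x) {f : ℝ → E → ℝ≥0∞}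
    (hf : Measurable (Function.uncurry f)) (hmono : ∀ y, MonotoneOn (fun a => f a y) (Ici 0))
    (hcont : ∀ y a, 0 ≤ a → ContinuousWithinAt (fun b => f b y) (Icc 0 a) a)
    {w : E → ℝ≥0∞} (hw : Measurable w) (hw1 : ∀ x, w x ≤ 1) :
    ∑' k, ∫⁻ ω, w (X k ω) * negExp (∑' j, if j = k then 0 else f (ρ (X k ω)) (X j ω)) ∂μ =
      ∫⁻ x, w x * negExp (∫⁻ y, (1 - negExp (f (ρ x) y)) ∂Λ) ∂Λ := by
  -- A bounded weight need not be integrable, but it is on each of countably many disjoint pieces of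
  -- finite intensity, and both sides are additive in the weight.
  let S : ℕ → Set E := disjointed (spanningSets Λ)
  have hS : ∀ n, MeasurableSet (S n) := fun n =>
    MeasurableSet.disjointed (measurableSet_spanningSets Λ) n
  have hU : ⋃ n, S n = univ := by rw [iUnion_disjointed, iUnion_spanningSets]
  have hdec : ∀ x, w x = ∑' n, (S n).indicator w x := fun x => by
    obtain ⟨n, hn⟩ := mem_iUnion.1 (hU ▸ mem_univ x)
    rw [tsum_eq_single n fun m hm => indicator_of_notMem (fun hx =>
      disjoint_left.1 (disjoint_disjointed (spanningSets Λ) hm) hx hn) _, indicator_of_mem hn]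
  have hfin : ∀ n, ∫⁻ x, (S n).indicator w x ∂Λ ≠ ⊤ := fun n => by
    rw [lintegral_indicator (hS n)]
    refine ((lintegral_mono fun x => hw1 x).trans_lt ?_).ne
    rw [lintegral_const, one_mul, Measure.restrict_apply_univ]
    exact (measure_mono (disjointed_subset _ n)).trans_lt (measure_spanningSets_lt_top Λ n)
  have hterm : ∀ k, Measurable fun ω =>
      negExp (∑' j, if j = k then 0 else f (ρ (X k ω)) (X j ω)) := fun k => by
    refine measurable_negExp.comp (Measurable.tsum fun j => ?_)
    split_ifs
    · exact measurable_const
    · exact hf.comp ((hρ.comp (hX k)).prodMk (hX j))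
  have hR : Measurable fun x => negExp (∫⁻ y, (1 - negExp (f (ρ x) y)) ∂Λ) :=
    measurable_negExp.comp (Measurable.lintegral_prod_right
      (f := fun x y => 1 - negExp (f (ρ x) y)) ((measurable_negExp.comp
        (hf.comp ((hρ.comp measurable_fst).prodMk measurable_snd))).const_sub 1))
  have hfa : ∀ a, Measurable (f a) := fun a => hf.comp measurable_prodMk_left
  have hwR : ∀ n, Measurable fun x =>
      (S n).indicator w x * negExp (∫⁻ y, (1 - negExp (f (ρ x) y)) ∂Λ) :=
    fun n => (hw.indicator (hS n)).mul hR
  simp_rw [hdec, ← ENNReal.tsum_mul_right]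
  rw [lintegral_tsum fun n => (hwR n).aemeasurable]
  simp_rw [← fun n => h.tsum_lintegral_mul_negExp_mono_of_lintegral_ne_top hX hρ hρ0 hfa hmono hcont
    (hw.indicator (hS n)) (hfin n)]
  rw [ENNReal.tsum_comm]
  exact tsum_congr fun k => lintegral_tsum fun n =>
    (((hw.indicator (hS n)).comp (hX k)).mul (hterm k)).aemeasurable

end IsPoissonProcess

/-! ### The exponential distribution -/

/-- This exponential tail is what makes the coverage probability a Laplace transform of noise and
interference. -/
lemma expMeasure_lt_ofReal (y : ℝ≥0∞) : expMeasure 1 {z | y < ENNReal.ofReal z} = negExp y := by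
  have := isProbabilityMeasure_expMeasure (r := 1) one_pos
  rcases eq_or_ne y ⊤ with rfl | hy
  · simp
  have hset : {z : ℝ | y < ENNReal.ofReal z} = (Iic y.toReal)ᶜ := by
    ext z
    show y < ENNReal.ofReal z ↔ ¬ z ≤ y.toReal
    rw [not_le, ENNReal.lt_ofReal_iff_toReal_lt hy]
  have h1 := cdf_expMeasure_eq (r := 1) one_pos y.toReal
  rw [if_pos ENNReal.toReal_nonneg, cdf_eq_real, one_mul] at h1
  rw [hset, ← ofReal_measureReal, probReal_compl_eq_one_sub measurableSet_Iic, h1, negExp_eq_ofReal hy,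
    sub_sub_cancel]

lemma lintegral_negExp_expMeasure {u : ℝ} (hu : 0 ≤ u) :
    ∫⁻ z, negExp (ENNReal.ofReal (u * z)) ∂(expMeasure 1) = ENNReal.ofReal (1 + u)⁻¹ := by
  have hpdf : Measurable (exponentialPDF 1) := (measurable_exponentialPDFReal 1).ennreal_ofReal
  have hdef : expMeasure 1 = volume.withDensity (exponentialPDF 1) := rfl
  have hm : Measurable fun z : ℝ => negExp (ENNReal.ofReal (u * z)) := by fun_prop
  rw [hdef, lintegral_withDensity_eq_lintegral_mul _ hpdf hm]
  calc ∫⁻ z, (exponentialPDF 1 * fun z => negExp (ENNReal.ofReal (u * z))) z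
      = ∫⁻ z, ENNReal.ofReal (1 + u)⁻¹ * exponentialPDF (1 + u) z := by
        refine lintegral_congr fun z => ?_
        rw [Pi.mul_apply]
        rcases lt_or_ge z 0 with hz | hz
        · rw [exponentialPDF_of_neg hz, exponentialPDF_of_neg hz, zero_mul, mul_zero]
        · rw [exponentialPDF_of_nonneg hz, exponentialPDF_of_nonneg hz, negExp_ofReal (by positivity),
            ← ENNReal.ofReal_mul (by positivity), ← ENNReal.ofReal_mul (by positivity)]
          congr 1
          rw [one_mul, ← Real.exp_add, ← mul_assoc, inv_mul_cancel₀ (by positivity), one_mul,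
            one_mul]
          congr 1
          ring
    _ = ENNReal.ofReal (1 + u)⁻¹ := by
        rw [lintegral_const_mul' _ _ ENNReal.ofReal_ne_top,
          lintegral_exponentialPDF_eq_one (by linarith), mul_one]

/-- The function `z exp (-z)` is the density of the Gamma law with shape `2` and rate `1`, so its
total mass is `1`. -/
lemma lintegral_id_expMeasure : ∫⁻ z, ENNReal.ofReal z ∂(expMeasure 1) = 1 := by
  have hpdf : Measurable (exponentialPDF 1) := (measurable_exponentialPDFReal 1).ennreal_ofReal
  have hdef : expMeasure 1 = volume.withDensity (exponentialPDF 1) := rfl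
  rw [hdef, lintegral_withDensity_eq_lintegral_mul _ hpdf ENNReal.measurable_ofReal,
    ← lintegral_gammaPDF_eq_one (a := 2) (r := 1) two_pos one_pos]
  refine lintegral_congr fun z => ?_
  rw [Pi.mul_apply]
  rcases lt_or_ge z 0 with hz | hz
  · rw [exponentialPDF_of_neg hz, gammaPDF_of_neg hz, zero_mul]
  · rw [exponentialPDF_of_nonneg hz, gammaPDF_of_nonneg hz, ← ENNReal.ofReal_mul (by positivity)]
    congr 1
    have : (2 : ℝ) - 1 = 1 := by norm_num
    simp [this, mul_comm]

lemma negLog_one : negLog 1 = 0 := by simp [negLog]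

lemma negLog_ofReal_inv {u : ℝ} (hu : 0 ≤ u) :
    negLog (ENNReal.ofReal (1 + u)⁻¹) = ENNReal.ofReal (Real.log (1 + u)) := by
  rw [negLog, ENNReal.log_ofReal_of_pos (by positivity), Real.log_inv, EReal.coe_neg, neg_neg,
    EReal.toENNReal_of_ne_top (EReal.coe_ne_top _), EReal.toReal_coe]

/-! ### Independent marks -/

/-- Only the `Z j` with `j ≠ k` need be measurable, so that the σ-algebra on `Ω` may be the one they
generate; this yields independence from `Z k`. -/
lemma measurable_tsum_ite_ofReal_mul {Ω : Type*} [MeasurableSpace Ω] {Z : ℕ → Ω → ℝ} {k : ℕ}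
    (hZ : ∀ j, j ≠ k → Measurable (Z j)) (t : ℕ → ℝ) :
    Measurable fun ω => ∑' j, if j = k then 0 else ENNReal.ofReal (t j * Z j ω) := by
  refine Measurable.tsum fun j => ?_
  split_ifs with h
  · exact measurable_const
  · exact ((hZ j h).const_mul _).ennreal_ofReal

section Independence

variable {Ω : Type*} [MeasurableSpace Ω] {μ : Measure Ω}

/-- Fubini's theorem for the joint law of two independent random variables. -/
lemma measure_prodMk_mem_of_indepFun [IsProbabilityMeasure μ] {β γ : Type*} [MeasurableSpace β]
    [MeasurableSpace γ] {U : Ω → β} {V : Ω → γ} (hU : Measurable U) (hV : Measurable V)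
    (hUV : IndepFun U V μ) {S : Set (β × γ)} (hS : MeasurableSet S) :
    μ {ω | (U ω, V ω) ∈ S} = ∫⁻ ω, μ {ω' | (U ω, V ω') ∈ S} ∂μ := by
  have h1 : μ {ω | (U ω, V ω) ∈ S} = μ.map (fun ω => (U ω, V ω)) S :=
    (Measure.map_apply (hU.prodMk hV) hS).symm
  have : IsProbabilityMeasure (μ.map V) := Measure.isProbabilityMeasure_map hV.aemeasurable
  rw [h1, (indepFun_iff_map_prod_eq_prod_map_map hU.aemeasurable hV.aemeasurable).1 hUV,
    Measure.prod_apply hS, lintegral_map (measurable_measure_prodMk_left hS) hU]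
  refine lintegral_congr fun ω => ?_
  rw [Measure.map_apply hV (measurable_prodMk_left hS)]
  rfl

/-- The probability that the `k`-th of a sequence of i.i.d. events occurs and none of those with
indices in a given set does. -/
lemma measure_and_forall_not_of_iIndepFun [IsProbabilityMeasure μ] {β : Type*} [MeasurableSpace β]
    {c : ℕ → Ω → β} (hc : ∀ k, Measurable (c k)) (hind : iIndepFun c μ) {T : Set β}
    (hT : MeasurableSet T) {p : ℝ} (hp : ∀ k, μ.real {ω | c k ω ∈ T} = p) (k : ℕ)
    (J : ℕ → Prop) [DecidablePred J] (hJ : ¬ J k) :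
    μ {ω | c k ω ∈ T ∧ ∀ j, c j ω ∈ T → ¬ J j} = ENNReal.ofReal p *
      negExp (∑' j, if j = k then 0 else if J j then negLog (ENNReal.ofReal (1 - p)) else 0) := by
  classical
  -- Penalties `0` or `⊤`: the exponential of minus their sum is the indicator of the event, whose
  -- probability is then a Laplace transform of independent variables.
  let φ : ℕ → β → ℝ≥0∞ := fun j y => if j = k then if y ∈ T then 0 else ⊤ else
    if J j then if y ∈ T then ⊤ else 0 else 0
  have hφ : ∀ j, Measurable (φ j) := fun j => by
    by_cases h1 : j = k
    · simp only [φ, if_pos h1]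
      exact Measurable.ite hT measurable_const measurable_const
    · by_cases h2 : J j
      · simp only [φ, if_neg h1, if_pos h2]
        exact Measurable.ite hT measurable_const measurable_const
      · simp only [φ, if_neg h1, if_neg h2]
        exact measurable_const
  have hTm : ∀ j, MeasurableSet {ω | c j ω ∈ T} := fun j => hc j hT
  have hμT : ∀ j, μ {ω | c j ω ∈ T} = ENNReal.ofReal p := fun j => by
    rw [← hp j, ofReal_measureReal]
  have hμTc : ∀ j, μ {ω | c j ω ∈ T}ᶜ = ENNReal.ofReal (1 - p) := fun j => by
    rw [← hp j, ← probReal_compl_eq_one_sub (hTm j), ofReal_measureReal]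
  have hp1 : ENNReal.ofReal p ≤ 1 := by rw [← hμT k]; exact prob_le_one
  have hlap := lintegral_negExp_tsum_of_iIndepFun (hind.comp φ hφ) fun j => (hφ j).comp (hc j)
  have hE : ∀ j, negLog (∫⁻ ω, negExp (φ j (c j ω)) ∂μ) =
      if j = k then negLog (ENNReal.ofReal p) else
        if J j then negLog (ENNReal.ofReal (1 - p)) else 0 := fun j => by
    by_cases h1 : j = k
    · rw [if_pos h1, ← hμT j, ← lintegral_indicator_one (hTm j)]
      congr 1
      refine lintegral_congr fun ω => ?_
      by_cases h : c j ω ∈ T <;> simp [φ, h1] <;> simp [← h1, h]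
    · by_cases h2 : J j
      · rw [if_neg h1, if_pos h2, ← hμTc j, ← lintegral_indicator_one (hTm j).compl]
        congr 1
        refine lintegral_congr fun ω => ?_
        by_cases h : c j ω ∈ T <;> simp [φ, h1, h2, h]
      · simp [φ, h1, h2, negLog_one]
  have hset : MeasurableSet {ω | c k ω ∈ T ∧ ∀ j, c j ω ∈ T → ¬ J j} := by
    refine (hTm k).inter ?_
    have : {ω | ∀ j, c j ω ∈ T → ¬ J j} = ⋂ j, {ω | c j ω ∈ T → ¬ J j} := by ext; simp
    change MeasurableSet {ω | ∀ j, c j ω ∈ T → ¬ J j}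
    rw [this]
    refine MeasurableSet.iInter fun j => ?_
    by_cases h : J j
    · simp only [h, not_true_eq_false, imp_false]
      exact (hTm j).compl
    · simp [h]
  have hev : ∀ ω, negExp (∑' j, φ j (c j ω)) =
      {ω | c k ω ∈ T ∧ ∀ j, c j ω ∈ T → ¬ J j}.indicator 1 ω := fun ω => by
    by_cases h : c k ω ∈ T ∧ ∀ j, c j ω ∈ T → ¬ J j
    · rw [indicator_of_mem (show ω ∈ {ω | c k ω ∈ T ∧ ∀ j, c j ω ∈ T → ¬ J j} from h)]
      rw [ENNReal.tsum_eq_zero.2 fun j => ?_, negExp_zero, Pi.one_apply]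
      by_cases h1 : j = k
      · subst h1; simp [φ, h.1]
      · by_cases h2 : J j
        · have : c j ω ∉ T := fun hj => h.2 j hj h2
          simp [φ, h1, this]
        · simp [φ, h1, h2]
    · rw [indicator_of_notMem (show ω ∉ {ω | c k ω ∈ T ∧ ∀ j, c j ω ∈ T → ¬ J j} from h)]
      have : ∃ j, φ j (c j ω) = ⊤ := by
        by_cases hk : c k ω ∈ T
        · have h' : ∃ j, c j ω ∈ T ∧ J j := by
            by_contra! hcon
            exact h ⟨hk, hcon⟩
          obtain ⟨j, hj, hJj⟩ := h'
          have hjk : j ≠ k := fun e => hJ (e ▸ hJj)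
          exact ⟨j, by simp [φ, hjk, hJj, hj]⟩
        · exact ⟨k, by simp [φ, hk]⟩
      obtain ⟨j, hj⟩ := this
      rw [ENNReal.tsum_eq_top_of_eq_top ⟨j, hj⟩, negExp_top]
  rw [← lintegral_indicator_one hset, ← lintegral_congr hev]
  refine hlap.trans ?_
  simp only [Function.comp_apply, hE]
  rw [ENNReal.tsum_eq_add_tsum_ite k, if_pos rfl, negExp_add, negExp_negLog hp1]
  congr 2
  refine tsum_congr fun j => ?_
  split_ifs <;> rfl

/-- The probability that an exponential random variable exceeds the weighted sum of others, in the
form of a signal to interference and noise ratio. -/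
lemma measure_lt_div_of_iIndepFun [IsProbabilityMeasure μ] {Z : ℕ → Ω → ℝ}
    (hZ : ∀ k, Measurable (Z k)) (hind : iIndepFun Z μ) (hlaw : ∀ k, HasLaw (Z k) (expMeasure 1) μ)
    (k : ℕ) {a τ : ℝ} (ha : 0 < a) (hτ : 0 ≤ τ) {D : ℝ≥0∞} (hD : D ≠ ⊤) {t : ℕ → ℝ}
    (ht : ∀ j, 0 ≤ t j) (hfin : ∑' j, ENNReal.ofReal (t j) ≠ ⊤) :
    μ {ω | ENNReal.ofReal τ < ENNReal.ofReal (a * Z k ω) /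
        (D + ∑' j, if j = k then 0 else ENNReal.ofReal (t j * Z j ω))} =
      negExp (ENNReal.ofReal (τ / a) * D) *
        negExp (∑' j, if j = k then 0 else ENNReal.ofReal (Real.log (1 + τ / a * t j))) := by
  let W : Ω → ℝ≥0∞ := fun ω => ∑' j, if j = k then 0 else ENNReal.ofReal (t j * Z j ω)
  have hWj : ∀ j, Measurable fun ω => if j = k then 0 else ENNReal.ofReal (t j * Z j ω) :=
    fun j => by
      have := hZ j
      split_ifs
      · exact measurable_const
      · fun_prop
  have hW : Measurable W := Measurable.tsum hWj
  have hWfin : ∀ᵐ ω ∂μ, W ω < ⊤ := by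
    refine ae_lt_top hW (ne_top_of_le_ne_top hfin ?_)
    rw [lintegral_tsum fun j => (hWj j).aemeasurable]
    refine ENNReal.tsum_le_tsum fun j => ?_
    split_ifs with h
    · simp
    · simp_rw [ENNReal.ofReal_mul (ht j)]
      rw [lintegral_const_mul' _ _ ENNReal.ofReal_ne_top,
        (hlaw j).lintegral_comp ENNReal.measurable_ofReal.aemeasurable, lintegral_id_expMeasure,
        mul_one]
  have hsa : ENNReal.ofReal τ = ENNReal.ofReal a * ENNReal.ofReal (τ / a) := by
    rw [← ENNReal.ofReal_mul ha.le, mul_div_cancel₀ _ ha.ne']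
  have ha0 : ENNReal.ofReal a ≠ 0 := by simpa using ha
  -- A zero denominator is allowed, since `τ` is finite; an infinite one is excluded almost surely
  -- by the finite mean of `W`.
  have hev : ∀ ω, W ω < ⊤ → (ENNReal.ofReal τ < ENNReal.ofReal (a * Z k ω) / (D + W ω) ↔
      ENNReal.ofReal (τ / a) * (D + W ω) < ENNReal.ofReal (Z k ω)) := fun ω hω => by
    have htop : D + W ω ≠ ⊤ := ENNReal.add_ne_top.2 ⟨hD, hω.ne⟩
    rw [ENNReal.lt_div_iff_mul_lt (Or.inr ENNReal.ofReal_ne_top) (Or.inl htop), hsa, mul_assoc,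
      ENNReal.ofReal_mul ha.le]
    exact ENNReal.mul_lt_mul_iff_right ha0 ENNReal.ofReal_ne_top
  -- The sum is measurable for the σ-algebra generated by the `Z j` with `j ≠ k`, which is
  -- independent of `Z k`.
  have hindep : IndepFun W (Z k) μ := by
    have h1 := indep_iSup_of_disjoint (m := fun i => MeasurableSpace.comap (Z i) inferInstance)
      (fun i => (hZ i).comap_le) hind (S := {k}ᶜ) (T := {k}) disjoint_compl_left
    rw [IndepFun_iff_Indep]
    refine indep_of_indep_of_le_left (indep_of_indep_of_le_right h1 ?_) ?_
    · exact le_iSup₂_of_le k (mem_singleton k) le_rfl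
    · refine Measurable.comap_le (@measurable_tsum_ite_ofReal_mul Ω
        (⨆ i ∈ ({k}ᶜ : Set ℕ), MeasurableSpace.comap (Z i) inferInstance) Z k (fun j h => ?_) t)
      exact (comap_measurable (Z j)).mono (le_iSup₂_of_le j h le_rfl) le_rfl
  have hS : MeasurableSet {q : ℝ≥0∞ × ℝ | ENNReal.ofReal (τ / a) * (D + q.1) < ENNReal.ofReal q.2} :=
    measurableSet_lt (by fun_prop) (by fun_prop)
  have hind' : iIndepFun (fun j ω => if j = k then 0 else ENNReal.ofReal (τ / a * t j * Z j ω)) μ :=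
    hind.comp (fun j z => if j = k then 0 else ENNReal.ofReal (τ / a * t j * z)) fun j => by
      split_ifs
      · exact measurable_const
      · fun_prop
  have hmeas' : ∀ j, Measurable fun ω => if j = k then 0 else ENNReal.ofReal (τ / a * t j * Z j ω) :=
    fun j => by
      have := hZ j
      split_ifs
      · exact measurable_const
      · fun_prop
  calc μ {ω | ENNReal.ofReal τ < ENNReal.ofReal (a * Z k ω) / (D + W ω)}
      = μ {ω | ENNReal.ofReal (τ / a) * (D + W ω) < ENNReal.ofReal (Z k ω)} := by
        refine measure_congr ?_
        filter_upwards [hWfin] with ω hω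
        exact propext (hev ω hω)
    -- For a fixed value of `W`, the probability is an exponential tail.
    _ = ∫⁻ ω, negExp (ENNReal.ofReal (τ / a) * (D + W ω)) ∂μ := by
        refine (measure_prodMk_mem_of_indepFun hW (hZ k) hindep hS).trans
          (lintegral_congr fun ω => ?_)
        rw [← expMeasure_lt_ofReal, ← (hlaw k).map_eq, Measure.map_apply (hZ k)
          (measurableSet_lt measurable_const ENNReal.measurable_ofReal)]
        rfl
    _ = negExp (ENNReal.ofReal (τ / a) * D) *
          ∫⁻ ω, negExp (∑' j, if j = k then 0 else ENNReal.ofReal (τ / a * t j * Z j ω)) ∂μ := by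
        rw [← lintegral_const_mul' _ _ (negExp_ne_top _)]
        refine lintegral_congr fun ω => ?_
        rw [← negExp_add, mul_add, ← ENNReal.tsum_mul_left]
        congr 3 with j
        split_ifs
        · simp
        · rw [← ENNReal.ofReal_mul (by positivity), mul_assoc]
    _ = _ := by
        rw [lintegral_negExp_tsum_of_iIndepFun hind' hmeas']
        congr 3 with j
        have h0 : 0 ≤ τ / a * t j := mul_nonneg (by positivity) (ht j)
        split_ifs
        · simp [negLog_one]
        · rw [(hlaw j).lintegral_comp
            (f := fun z => negExp (ENNReal.ofReal (τ / a * t j * z))) (by fun_prop),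
            lintegral_negExp_expMeasure h0, negLog_ofReal_inv h0]

end Independence

/-! ### The Gauss hypergeometric function with parameters `-δ`, `1`, `1 - δ` -/

section Hypergeometric

lemma isOpen_hypergeometricDomain : IsOpen hypergeometricDomain := by
  have : hypergeometricDomain = ({z : ℂ | 1 ≤ z.re} ∩ {z : ℂ | z.im = 0})ᶜ := rfl
  rw [this, isOpen_compl_iff]
  exact (isClosed_le continuous_const Complex.continuous_re).inter
    (isClosed_eq Complex.continuous_im continuous_const)

lemma one_sub_mul_ne_zero_of_mem_hypergeometricDomain {z : ℂ} (hz : z ∈ hypergeometricDomain)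
    {v : ℝ} (hv0 : 0 ≤ v) (hv1 : v ≤ 1) : 1 - z * v ≠ 0 := fun h => by
  have h1 : z * v = 1 := (sub_eq_zero.1 h).symm
  have hv : v ≠ 0 := by rintro rfl; simp at h1
  have hpos : 0 < v := lt_of_le_of_ne hv0 hv.symm
  have hz' : z = ((v⁻¹ : ℝ) : ℂ) := by
    rw [Complex.ofReal_inv]
    exact eq_inv_of_mul_eq_one_left h1
  refine hz ⟨?_, ?_⟩
  · rw [hz', Complex.ofReal_re]; exact (one_le_inv₀ hpos).2 hv1
  · rw [hz', Complex.ofReal_im]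

/-- Euler's integral for the hypergeometric function with parameters `-δ`, `1`, `1 - δ`. -/
noncomputable def eulerIntegral (δ : ℝ) (z : ℂ) : ℂ :=
  1 - δ * z * ∫ v in Ioo (0 : ℝ) 1, ((v ^ (-δ) : ℝ) : ℂ) * (1 - z * v)⁻¹

lemma integrableOn_rpow_neg {δ : ℝ} (hδ : δ < 1) :
    IntegrableOn (fun v : ℝ => v ^ (-δ)) (Ioo 0 1) :=
  (intervalIntegral.integrableOn_Ioo_rpow_iff one_pos).2 (by linarith)

/-- Differentiation under the integral sign: `1 - z v` does not vanish for `z` in a small closed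
ball in the cut plane and `v ∈ [0, 1]`, so by compactness the kernel is bounded there, and `v ^
(-δ)` is integrable for `δ < 1`. -/
lemma differentiableOn_eulerIntegral {δ : ℝ} (hδ : δ < 1) :
    DifferentiableOn ℂ (eulerIntegral δ) hypergeometricDomain := by
  intro z₀ hz₀
  obtain ⟨ε, hε, hball⟩ := Metric.nhds_basis_closedBall.mem_iff.1
    (isOpen_hypergeometricDomain.mem_nhds hz₀)
  have hne : ∀ z ∈ Metric.closedBall z₀ ε, ∀ v ∈ Icc (0 : ℝ) 1, 1 - z * v ≠ 0 := fun z hz v hv =>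
    one_sub_mul_ne_zero_of_mem_hypergeometricDomain (hball hz) hv.1 hv.2
  have hcont : ContinuousOn (fun q : ℂ × ℝ => (1 - q.1 * q.2)⁻¹)
      (Metric.closedBall z₀ ε ×ˢ Icc (0 : ℝ) 1) := by
    refine ContinuousOn.inv₀ (by fun_prop) fun q hq => hne _ hq.1 _ hq.2
  obtain ⟨M, hM⟩ := ((isCompact_closedBall z₀ ε).prod isCompact_Icc).exists_bound_of_continuousOn
    hcont
  have hM' : ∀ z ∈ Metric.closedBall z₀ ε, ∀ v ∈ Icc (0 : ℝ) 1, ‖(1 - z * v)⁻¹‖ ≤ M :=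
    fun z hz v hv => hM (z, v) ⟨hz, hv⟩
  have hM0 : 0 ≤ M := (norm_nonneg _).trans
    (hM' z₀ (Metric.mem_closedBall_self hε.le) 0 ⟨le_rfl, zero_le_one⟩)
  have hrpow : AEStronglyMeasurable (fun v : ℝ => ((v ^ (-δ) : ℝ) : ℂ))
      (volume.restrict (Ioo (0 : ℝ) 1)) :=
    (Complex.measurable_ofReal.comp (measurable_id.pow_const _)).aestronglyMeasurable
  have hinv : ∀ z : ℂ, Measurable fun v : ℝ => (1 - z * v)⁻¹ := fun z => by fun_prop
  have hint := integrableOn_rpow_neg hδ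
  have hnorm : ∀ v ∈ Ioo (0 : ℝ) 1, ‖((v ^ (-δ) : ℝ) : ℂ)‖ = v ^ (-δ) := fun v hv => by
    rw [Complex.norm_real, Real.norm_of_nonneg (Real.rpow_nonneg hv.1.le _)]
  have hderiv := hasDerivAt_integral_of_dominated_loc_of_deriv_le
    (μ := volume.restrict (Ioo (0 : ℝ) 1)) (x₀ := z₀)
    (F := fun (z : ℂ) (v : ℝ) => ((v ^ (-δ) : ℝ) : ℂ) * (1 - z * v)⁻¹)
    (F' := fun (z : ℂ) (v : ℝ) => ((v ^ (-δ) : ℝ) : ℂ) * (v * ((1 - z * v)⁻¹ * (1 - z * v)⁻¹)))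
    (bound := fun v => v ^ (-δ) * (M * M)) (Metric.closedBall_mem_nhds z₀ hε)
    (Eventually.of_forall fun z => hrpow.mul (hinv z).aestronglyMeasurable) ?_ ?_ ?_ ?_ ?_
  · have h2 := hderiv.2.differentiableAt
    have h3 : DifferentiableAt ℂ (eulerIntegral δ) z₀ := by
      unfold eulerIntegral
      exact (((differentiableAt_id.const_mul (δ : ℂ)).mul h2).const_sub 1)
    exact h3.differentiableWithinAt
  · refine Integrable.mono' (hint.mul_const M) (hrpow.mul (hinv z₀).aestronglyMeasurable) ?_
    filter_upwards [ae_restrict_mem measurableSet_Ioo] with v hv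
    rw [norm_mul, hnorm v hv]
    exact mul_le_mul_of_nonneg_left (hM' z₀ (Metric.mem_closedBall_self hε.le) v
      (Ioo_subset_Icc_self hv)) (Real.rpow_nonneg hv.1.le _)
  · exact hrpow.mul (by fun_prop)
  · filter_upwards [ae_restrict_mem measurableSet_Ioo] with v hv z hz
    have hb := hM' z hz v (Ioo_subset_Icc_self hv)
    rw [norm_mul, hnorm v hv, norm_mul, norm_mul, Complex.norm_real, Real.norm_of_nonneg hv.1.le]
    refine mul_le_mul_of_nonneg_left ?_ (Real.rpow_nonneg hv.1.le _)
    calc v * (‖(1 - z * v)⁻¹‖ * ‖(1 - z * v)⁻¹‖) ≤ 1 * (M * M) := by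
          gcongr
          exact hv.2.le
      _ = M * M := one_mul _
  · exact hint.mul_const _
  · filter_upwards [ae_restrict_mem measurableSet_Ioo] with v hv z hz
    have h0 := hne z hz v (Ioo_subset_Icc_self hv)
    have h1 : HasDerivAt (fun z : ℂ => 1 - z * v) (-v : ℂ) z := by
      simpa using ((hasDerivAt_id z).mul_const (v : ℂ)).const_sub 1
    exact ((h1.inv h0).const_mul ((v ^ (-δ) : ℝ) : ℂ)).congr_deriv (by
      rw [neg_neg, div_eq_mul_inv, sq, mul_inv])

lemma ascPochhammer_eval_mul_add (a : ℂ) (n : ℕ) :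
    (ascPochhammer ℂ n).eval a * (a + n) = a * (ascPochhammer ℂ n).eval (a + 1) := by
  rw [← ascPochhammer_succ_eval, ascPochhammer_succ_left]
  simp

lemma ascPochhammer_eval_ne_zero {a : ℂ} (ha : ∀ n : ℕ, a + n ≠ 0) (n : ℕ) :
    (ascPochhammer ℂ n).eval a ≠ 0 := by
  induction n with
  | zero => simp
  | succ n ih => rw [ascPochhammer_succ_eval]; exact mul_ne_zero ih (ha n)

/-- The Pochhammer quotient `(a)_n / (a + 1)_n` telescopes to `a / (a + n)`, and `(1)_n` cancels
`n!`. -/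
lemma ordinaryHypergeometric_one_eq_tsum {a : ℂ} (ha : ∀ n : ℕ, a + n ≠ 0) (z : ℂ) :
    ordinaryHypergeometric a 1 (a + 1) z = ∑' n : ℕ, a * (a + n)⁻¹ * z ^ n := by
  rw [ordinaryHypergeometric_eq_tsum]
  refine tsum_congr fun n => ?_
  have h1 : (ascPochhammer ℂ n).eval (a + 1) ≠ 0 := ascPochhammer_eval_ne_zero (fun m => by
    have := ha (m + 1)
    push_cast at this
    rwa [add_assoc, add_comm 1 (m : ℂ)]) n
  have h2 := ascPochhammer_eval_mul_add a n
  have h3 : (n.factorial : ℂ) ≠ 0 := Nat.cast_ne_zero.2 n.factorial_ne_zero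
  rw [ascPochhammer_eval_one, smul_eq_mul]
  congr 1
  have h4 := ha n
  field_simp
  rw [← h2]

/-- Expand `(1 - z v)⁻¹` in a geometric series and integrate termwise: the coefficient of `z ^ (n +
1)` is `-δ / (n + 1 - δ)`. The constant term stands apart in `eulerIntegral` because the
corresponding integral, of `v ^ (-δ - 1)`, diverges at `0`. -/
lemma eulerIntegral_eq_ordinaryHypergeometric {δ : ℝ} (hδ0 : 0 < δ) (hδ1 : δ < 1) {z : ℂ}
    (hz : ‖z‖ < 1) :
    eulerIntegral δ z = ordinaryHypergeometric (-δ : ℂ) 1 (-δ + 1) z := by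
  have hne' : ∀ n : ℕ, -δ + (n : ℝ) ≠ 0 := fun n h => by
    rcases n with _ | n
    · simp only [Nat.cast_zero, add_zero, neg_eq_zero] at h; linarith
    · push_cast at h
      have : (0 : ℝ) ≤ n := n.cast_nonneg
      linarith
  have hne : ∀ n : ℕ, (-δ + n : ℂ) ≠ 0 := fun n => by
    have := hne' n
    exact_mod_cast this
  have hpos : ∀ n : ℕ, 0 < n + 1 - δ := fun n => by
    have : (0 : ℝ) ≤ n := n.cast_nonneg
    linarith
  have hexp : ∀ n : ℕ, -1 < n - δ := fun n => by linarith [hpos n]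
  have hrpow : ∀ n : ℕ, ∫ v in Ioo (0 : ℝ) 1, v ^ (n - δ) = (n + 1 - δ)⁻¹ := fun n => by
    rw [← integral_Ioc_eq_integral_Ioo, ← intervalIntegral.integral_of_le zero_le_one,
      integral_rpow (Or.inl (hexp n)), Real.one_rpow, Real.zero_rpow (by linarith [hpos n]),
      sub_zero, one_div]
    ring_nf
  have hint : ∀ n : ℕ, IntegrableOn (fun v : ℝ => v ^ (n - δ)) (Ioo 0 1) := fun n =>
    (intervalIntegral.integrableOn_Ioo_rpow_iff one_pos).2 (hexp n)
  have hsum : HasSum (fun n : ℕ => z ^ n * ((n + 1 - δ)⁻¹ : ℝ))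
      (∫ v in Ioo (0 : ℝ) 1, ((v ^ (-δ) : ℝ) : ℂ) * (1 - z * v)⁻¹) := by
    have hS := hasSum_integral_of_summable_integral_norm (μ := volume.restrict (Ioo (0 : ℝ) 1))
      (F := fun (n : ℕ) (v : ℝ) => z ^ n * ((v ^ (n - δ) : ℝ) : ℂ))
      (fun n => ((hint n).ofReal (𝕜 := ℂ)).const_mul _) ?_
    · simp_rw [integral_const_mul, integral_complex_ofReal, hrpow] at hS
      suffices hI : ∫ v in Ioo (0 : ℝ) 1, ((v ^ (-δ) : ℝ) : ℂ) * (1 - z * v)⁻¹ =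
          ∫ v in Ioo (0 : ℝ) 1, ∑' n : ℕ, z ^ n * ((v ^ (n - δ) : ℝ) : ℂ) by
        rw [hI]; exact hS
      refine setIntegral_congr_fun measurableSet_Ioo fun v hv => ?_
      have hzv : ‖z * v‖ < 1 := by
        rw [norm_mul, Complex.norm_real, Real.norm_of_nonneg hv.1.le]
        nlinarith [norm_nonneg z, hv.1, hv.2]
      rw [← tsum_geometric_of_norm_lt_one hzv, ← tsum_mul_left]
      refine tsum_congr fun n => ?_
      rw [sub_eq_neg_add, Real.rpow_add hv.1, Real.rpow_natCast, mul_pow]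
      push_cast
      ring
    · have hn : ∀ n : ℕ, ∫ v in Ioo (0 : ℝ) 1, ‖z ^ n * ((v ^ (n - δ) : ℝ) : ℂ)‖ =
          ‖z‖ ^ n * (n + 1 - δ)⁻¹ := fun n => by
        rw [← hrpow n, ← integral_const_mul]
        refine setIntegral_congr_fun measurableSet_Ioo fun v hv => ?_
        rw [norm_mul, norm_pow, Complex.norm_real, Real.norm_of_nonneg (Real.rpow_nonneg hv.1.le _)]
      simp_rw [hn]
      refine Summable.of_nonneg_of_le (fun n => mul_nonneg (by positivity)
        (inv_nonneg.2 (hpos n).le)) (fun n => ?_)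
        ((summable_geometric_of_lt_one (norm_nonneg z) hz).mul_right (1 - δ)⁻¹)
      refine mul_le_mul_of_nonneg_left ?_ (by positivity)
      exact inv_anti₀ (by linarith) (by have : (0 : ℝ) ≤ n := n.cast_nonneg; linarith)
  have h1 := (hsum.mul_left (δ * z : ℂ)).tsum_eq
  have hterm : ∀ n : ℕ, -(δ : ℂ) * (-(δ : ℂ) + (n + 1 : ℕ))⁻¹ * z ^ (n + 1) =
      -(δ * z * (z ^ n * ((n + 1 - δ)⁻¹ : ℝ))) := fun n => by
    push_cast
    rw [show (-δ + (n + 1) : ℂ) = n + 1 - δ by ring]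
    ring
  have hsummable : Summable fun n : ℕ => -(δ : ℂ) * (-(δ : ℂ) + n)⁻¹ * z ^ n := by
    rw [← summable_nat_add_iff 1]
    simp_rw [hterm]
    exact (hsum.summable.mul_left _).neg
  rw [ordinaryHypergeometric_one_eq_tsum hne, hsummable.tsum_eq_zero_add]
  simp_rw [hterm]
  rw [tsum_neg, h1, eulerIntegral]
  have hδ : (δ : ℂ) ≠ 0 := by exact_mod_cast hδ0.ne'
  rw [Nat.cast_zero, add_zero, pow_zero, mul_one, mul_inv_cancel₀ (neg_ne_zero.2 hδ),
    sub_eq_add_neg]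

lemma neg_mem_hypergeometricDomain {τ : ℝ} (hτ : 0 ≤ τ) :
    ((-τ : ℝ) : ℂ) ∈ hypergeometricDomain := fun h => by
  have := h.1
  rw [Complex.ofReal_re] at this
  linarith

lemma hyperS_zero_one {α τ : ℝ} (hα : 2 < α) (hτ : 0 ≤ τ) :
    hyperS 0 1 α τ = 1 + 2 / α * τ * ∫ v in Ioo (0 : ℝ) 1, v ^ (-(2 / α)) * (1 + τ * v)⁻¹ := by
  have hδ0 : 0 < 2 / α := by positivity
  have hδ1 : 2 / α < 1 := (div_lt_one (by linarith)).2 hα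
  rw [hyperS]
  have h := gaussHypergeometric_eq (differentiableOn_eulerIntegral hδ1)
    (fun w hw => eulerIntegral_eq_ordinaryHypergeometric hδ0 hδ1 hw)
    (neg_mem_hypergeometricDomain hτ)
  have e1 : ((((0 : ℕ) : ℝ) - 2 / α : ℝ) : ℂ) = -((2 / α : ℝ) : ℂ) := by push_cast; ring
  have e2 : ((((0 : ℕ) : ℝ) + ((1 : ℕ) : ℝ) : ℝ) : ℂ) = 1 := by push_cast; ring
  have e3 : ((((0 : ℕ) : ℝ) + 1 - 2 / α : ℝ) : ℂ) = -((2 / α : ℝ) : ℂ) + 1 := by push_cast; ring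
  rw [e1, e2, e3, h, eulerIntegral]
  have hI : ∫ v in Ioo (0 : ℝ) 1, ((v ^ (-(2 / α)) : ℝ) : ℂ) * (1 - ((-τ : ℝ) : ℂ) * v)⁻¹ =
      ((∫ v in Ioo (0 : ℝ) 1, v ^ (-(2 / α)) * (1 + τ * v)⁻¹ : ℝ) : ℂ) := by
    rw [← integral_complex_ofReal]
    refine setIntegral_congr_fun measurableSet_Ioo fun v _ => ?_
    push_cast
    ring
  rw [hI]
  have : (1 - ((2 / α : ℝ) : ℂ) * ((-τ : ℝ) : ℂ) *
      ((∫ v in Ioo (0 : ℝ) 1, v ^ (-(2 / α)) * (1 + τ * v)⁻¹ : ℝ) : ℂ)) =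
      ((1 + 2 / α * τ * ∫ v in Ioo (0 : ℝ) 1, v ^ (-(2 / α)) * (1 + τ * v)⁻¹ : ℝ) : ℂ) := by
    push_cast
    ring
  rw [this, Complex.ofReal_re]

end Hypergeometric

/-! ### Integrals over the half-line -/

lemma lintegral_rpow_mul_exp_neg_mul {a r : ℝ} (ha : 0 < a) (hr : 0 < r) :
    ∫⁻ t in Ioi (0 : ℝ), ENNReal.ofReal (t ^ (a - 1) * Real.exp (-(r * t))) =
      ENNReal.ofReal ((1 / r) ^ a * Real.Gamma a) := by
  have h := Real.integral_rpow_mul_exp_neg_mul_Ioi ha hr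
  have hpos : 0 < (1 / r) ^ a * Real.Gamma a := by
    have := Real.Gamma_pos_of_pos ha
    positivity
  -- A non-integrable function would have integral `0` by convention, but the known value is
  -- positive.
  have hint : IntegrableOn (fun t : ℝ => t ^ (a - 1) * Real.exp (-(r * t))) (Ioi 0) := by
    by_contra hcon
    rw [integral_undef hcon] at h
    exact hpos.ne h
  rw [← h, ofReal_integral_eq_lintegral_ofReal hint]
  filter_upwards [ae_restrict_mem measurableSet_Ioi] with t ht
  exact mul_nonneg (Real.rpow_nonneg (mem_Ioi.1 ht).le _) (Real.exp_nonneg _)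

/-- The beta integral over the half-line. -/
lemma lintegral_rpow_neg_mul_inv {δ τ : ℝ} (hδ0 : 0 < δ) (hδ1 : δ < 1) (hτ : 0 < τ) :
    ∫⁻ v in Ioi (0 : ℝ), ENNReal.ofReal (v ^ (-δ) * (1 + τ * v)⁻¹) =
      ENNReal.ofReal (Real.Gamma (1 - δ) * Real.Gamma δ * τ ^ (δ - 1)) := by
  have hm : Measurable fun q : ℝ × ℝ =>
      ENNReal.ofReal (q.1 ^ (-δ) * Real.exp (-((1 + τ * q.1) * q.2))) := by fun_prop
  -- The factor `(1 + τ v)⁻¹` is written as the integral of `exp (-(1 + τ v) x)` over `x > 0`; after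
  -- Tonelli, each of the two integrations is a Gamma integral.
  calc ∫⁻ v in Ioi (0 : ℝ), ENNReal.ofReal (v ^ (-δ) * (1 + τ * v)⁻¹)
      = ∫⁻ v in Ioi (0 : ℝ), ∫⁻ x in Ioi (0 : ℝ),
          ENNReal.ofReal (v ^ (-δ) * Real.exp (-((1 + τ * v) * x))) := by
        refine setLIntegral_congr_fun measurableSet_Ioi fun v hv => ?_
        have hv0 : 0 < v := hv
        have h1 := lintegral_rpow_mul_exp_neg_mul (a := 1) (r := 1 + τ * v) one_pos (by positivity)
        simp only [sub_self, Real.rpow_zero, one_mul, Real.rpow_one, Real.Gamma_one, mul_one,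
          one_div] at h1
        have h2 : 0 ≤ v ^ (-δ) := Real.rpow_nonneg hv0.le _
        simp_rw [ENNReal.ofReal_mul h2]
        rw [lintegral_const_mul' _ _ ENNReal.ofReal_ne_top, h1]
    _ = ∫⁻ x in Ioi (0 : ℝ), ∫⁻ v in Ioi (0 : ℝ),
          ENNReal.ofReal (v ^ (-δ) * Real.exp (-((1 + τ * v) * x))) :=
        lintegral_lintegral_swap hm.aemeasurable
    _ = ∫⁻ x in Ioi (0 : ℝ), ENNReal.ofReal (Real.Gamma (1 - δ) * τ ^ (δ - 1)) *
          ENNReal.ofReal (x ^ (δ - 1) * Real.exp (-(1 * x))) := by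
        refine setLIntegral_congr_fun measurableSet_Ioi fun x hx => ?_
        have hx0 : 0 < x := hx
        have hG := Real.Gamma_pos_of_pos (sub_pos.2 hδ1)
        have h1 := lintegral_rpow_mul_exp_neg_mul (a := 1 - δ) (r := τ * x) (by linarith)
          (by positivity)
        have h2 : ∀ v : ℝ, v ^ (-δ) * Real.exp (-((1 + τ * v) * x)) =
            Real.exp (-x) * (v ^ (1 - δ - 1) * Real.exp (-(τ * x * v))) := fun v => by
          rw [show (1 : ℝ) - δ - 1 = -δ by ring, mul_left_comm, ← Real.exp_add]
          congr 2
          ring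
        simp_rw [h2, ENNReal.ofReal_mul (Real.exp_nonneg (-x))]
        rw [lintegral_const_mul' _ _ ENNReal.ofReal_ne_top, h1, ← ENNReal.ofReal_mul (by positivity),
          ← ENNReal.ofReal_mul (by positivity)]
        congr 1
        rw [one_div, Real.inv_rpow (by positivity), ← Real.rpow_neg (by positivity), neg_sub,
          Real.mul_rpow hτ.le hx0.le, one_mul]
        ring
    _ = ENNReal.ofReal (Real.Gamma (1 - δ) * Real.Gamma δ * τ ^ (δ - 1)) := by
        have hG := Real.Gamma_pos_of_pos (sub_pos.2 hδ1)
        rw [lintegral_const_mul' _ _ ENNReal.ofReal_ne_top,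
          lintegral_rpow_mul_exp_neg_mul hδ0 one_pos, ← ENNReal.ofReal_mul (by positivity)]
        congr 1
        rw [one_div, inv_one, Real.one_rpow]
        ring

lemma one_le_hyperS_zero_one {α τ : ℝ} (hα : 2 < α) (hτ : 0 ≤ τ) : 1 ≤ hyperS 0 1 α τ := by
  rw [hyperS_zero_one hα hτ, le_add_iff_nonneg_right]
  refine mul_nonneg (by positivity) (setIntegral_nonneg measurableSet_Ioo fun v hv => ?_)
  have := hv.1
  exact mul_nonneg (Real.rpow_nonneg hv.1.le _) (by positivity)

lemma gammaDelta_one_nonneg {α τ : ℝ} (hα : 2 < α) (hτ : 0 ≤ τ) : 0 ≤ gammaDelta 1 α τ := by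
  have h1 := Real.Gamma_pos_of_pos (sub_pos.2 ((div_lt_one (by linarith)).2 hα))
  have h2 : 0 < Real.Gamma ((1 : ℕ) + 2 / α) := Real.Gamma_pos_of_pos (by positivity)
  have h3 : 0 < Real.Gamma ((1 : ℕ) : ℝ) := Real.Gamma_pos_of_pos (by positivity)
  have h4 := Real.rpow_nonneg hτ (2 / α)
  rw [gammaDelta]
  positivity

/-- The integral that defines the void probability of the interference field. -/
lemma lintegral_radial_exponent {α τ p : ℝ} (hα : 2 < α) (hτ : 0 ≤ τ) (hp0 : 0 ≤ p) (hp1 : p ≤ 1) :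
    ∫⁻ v in Ioi (0 : ℝ), ENNReal.ofReal (2 / α * v ^ (-(2 / α) - 1) *
        (1 - (if 1 < v then 1 - p else 1) * (1 + τ * v)⁻¹)) =
      ENNReal.ofReal (p * hyperS 0 1 α τ + (1 - p) * gammaDelta 1 α τ) := by
  set δ := 2 / α with hδ
  have hδ0 : 0 < δ := by positivity
  have hδ1 : δ < 1 := (div_lt_one (by linarith)).2 hα
  have hbase : ∀ v : ℝ, 0 < v → 0 ≤ v ^ (-δ) * (1 + τ * v)⁻¹ := fun v hv =>
    mul_nonneg (Real.rpow_nonneg hv.le _) (by positivity)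
  have hA : ∫⁻ v in Ioi (0 : ℝ), ENNReal.ofReal (δ * τ * (v ^ (-δ) * (1 + τ * v)⁻¹)) =
      ENNReal.ofReal (gammaDelta 1 α τ) := by
    rw [gammaDelta, ← hδ]
    rcases hτ.eq_or_lt with rfl | hτ'
    · simp [Real.zero_rpow hδ0.ne']
    · have h0 : 0 ≤ δ * τ := by positivity
      simp_rw [ENNReal.ofReal_mul h0]
      rw [lintegral_const_mul' _ _ ENNReal.ofReal_ne_top, lintegral_rpow_neg_mul_inv hδ0 hδ1 hτ',
        ← ENNReal.ofReal_mul h0]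
      congr 1
      rw [Nat.cast_one, Real.Gamma_one, add_comm 1 δ, Real.Gamma_add_one hδ0.ne',
        Real.rpow_sub_one hτ'.ne']
      field_simp
  have hB : ∫⁻ v in Ioo (0 : ℝ) 1, ENNReal.ofReal (δ * τ * (v ^ (-δ) * (1 + τ * v)⁻¹)) =
      ENNReal.ofReal (hyperS 0 1 α τ - 1) := by
    rw [hyperS_zero_one hα hτ, add_sub_cancel_left, ← hδ, ← integral_const_mul]
    refine (ofReal_integral_eq_lintegral_ofReal ?_ ?_).symm
    · refine Integrable.const_mul ?_ _
      refine Integrable.mono' (integrableOn_rpow_neg hδ1) (by fun_prop) ?_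
      filter_upwards [ae_restrict_mem measurableSet_Ioo] with v hv
      rw [Real.norm_of_nonneg (hbase v hv.1)]
      refine mul_le_of_le_one_right (Real.rpow_nonneg hv.1.le _) (inv_le_one_of_one_le₀ ?_)
      have := mul_nonneg hτ hv.1.le
      linarith
    · filter_upwards [ae_restrict_mem measurableSet_Ioo] with v hv
      exact mul_nonneg (by positivity) (hbase v hv.1)
  -- This is the normalized area of the disc of nearer stations.
  have hC : ∫⁻ v in Ioi (1 : ℝ), ENNReal.ofReal (δ * v ^ (-δ - 1)) = 1 := by
    rw [← ofReal_integral_eq_lintegral_ofReal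
      ((integrableOn_Ioi_rpow_of_lt (by linarith) one_pos).const_mul δ), integral_const_mul,
      integral_Ioi_rpow_of_lt (by linarith) one_pos, Real.one_rpow, sub_add_cancel, neg_div_neg_eq,
      mul_one_div_cancel hδ0.ne', ENNReal.ofReal_one]
    filter_upwards [ae_restrict_mem measurableSet_Ioi] with v hv
    exact mul_nonneg hδ0.le (Real.rpow_nonneg (zero_le_one.trans (mem_Ioi.1 hv).le) _)
  have hS1 : 0 ≤ hyperS 0 1 α τ - 1 := sub_nonneg.2 (one_le_hyperS_zero_one hα hτ)
  have hΔ : 0 ≤ gammaDelta 1 α τ := gammaDelta_one_nonneg hα hτ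
  let A : ℝ → ℝ≥0∞ := fun v => ENNReal.ofReal (δ * τ * (v ^ (-δ) * (1 + τ * v)⁻¹))
  let C : ℝ → ℝ≥0∞ := fun v => ENNReal.ofReal (δ * v ^ (-δ - 1))
  have hAm : Measurable A := by fun_prop
  have hCm : Measurable C := by fun_prop
  have hACm : Measurable fun v => (Ioo 0 1).indicator A v + (Ioi 1).indicator C v :=
    (hAm.indicator measurableSet_Ioo).add (hCm.indicator measurableSet_Ioi)
  have hne : ∀ᵐ v : ℝ ∂(volume.restrict (Ioi 0)), v ≠ 1 :=
    ae_restrict_of_ae (by simp [ae_iff])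
  -- The integrand is split according to the cache. A weight `1 - p` goes to `τ v / (1 + τ v)` on
  -- the whole half-line, which gives `Δ`. A weight `p` goes to the same function for `v < 1` and to
  -- `1` for `v > 1`, which give `S - 1` and `1`.
  calc ∫⁻ v in Ioi (0 : ℝ), ENNReal.ofReal (δ * v ^ (-δ - 1) *
        (1 - (if 1 < v then 1 - p else 1) * (1 + τ * v)⁻¹))
      = ∫⁻ v in Ioi (0 : ℝ), (ENNReal.ofReal (1 - p) * A v + ENNReal.ofReal p *
          ((Ioo 0 1).indicator A v + (Ioi 1).indicator C v)) := by
        refine lintegral_congr_ae ?_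
        filter_upwards [ae_restrict_mem measurableSet_Ioi, hne] with v hv hv1
        have hv0 : 0 < v := hv
        have hpow : v ^ (-δ - 1) * v = v ^ (-δ) := by
          rw [Real.rpow_sub_one hv0.ne', div_mul_cancel₀ _ hv0.ne']
        have hr : 0 ≤ v ^ (-δ - 1) := Real.rpow_nonneg hv0.le _
        have hden : (0 : ℝ) < 1 + τ * v := by positivity
        have hA0 : 0 ≤ δ * τ * (v ^ (-δ) * (1 + τ * v)⁻¹) := mul_nonneg (by positivity) (hbase v hv0)
        have hC0 : 0 ≤ δ * v ^ (-δ - 1) := by positivity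
        have hp1' : 0 ≤ 1 - p := by linarith
        rcases lt_or_gt_of_ne hv1 with hlt | hgt
        · rw [if_neg (not_lt.2 hlt.le), indicator_of_mem (show v ∈ Ioo (0 : ℝ) 1 from ⟨hv0, hlt⟩),
            indicator_of_notMem (by simpa using hlt.le), add_zero, ← ENNReal.ofReal_mul hp1',
            ← ENNReal.ofReal_mul hp0, ← ENNReal.ofReal_add (by positivity) (by positivity), ← hpow]
          congr 1
          field_simp
          ring
        · rw [if_pos hgt, indicator_of_mem (show v ∈ Ioi (1 : ℝ) from hgt),
            indicator_of_notMem (show v ∉ Ioo (0 : ℝ) 1 from fun h => hgt.not_gt h.2), zero_add,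
            ← ENNReal.ofReal_mul hp1', ← ENNReal.ofReal_mul hp0,
            ← ENNReal.ofReal_add (by positivity) (by positivity), ← hpow]
          congr 1
          field_simp
          ring
    _ = ENNReal.ofReal (1 - p) * ENNReal.ofReal (gammaDelta 1 α τ) +
          ENNReal.ofReal p * (ENNReal.ofReal (hyperS 0 1 α τ - 1) + 1) := by
        rw [lintegral_add_left (hAm.const_mul _), lintegral_const_mul _ hAm, hA,
          lintegral_const_mul _ hACm,
          lintegral_add_left (hAm.indicator measurableSet_Ioo), setLIntegral_indicator
          measurableSet_Ioo, setLIntegral_indicator measurableSet_Ioi,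
          inter_eq_left.2 Ioo_subset_Ioi_self, inter_eq_left.2 (Ioi_subset_Ioi zero_le_one), hB, hC]
    _ = _ := by
        rw [← ENNReal.ofReal_one, ← ENNReal.ofReal_add hS1 zero_le_one,
          ← ENNReal.ofReal_mul (by linarith), ← ENNReal.ofReal_mul hp0,
          ← ENNReal.ofReal_add (mul_nonneg (by linarith) hΔ) (by positivity)]
        congr 1
        ring

/-! ### Integration in polar coordinates -/

/-- The origin is null, and the unit circle has total mass `2π`, namely the dimension times the area
of the unit disc. -/
lemma lintegral_comp_norm_plane {g : ℝ → ℝ≥0∞} (hg : Measurable g) :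
    ∫⁻ x : Plane, g ‖x‖ = ∫⁻ r in Ioi (0 : ℝ), ENNReal.ofReal (2 * Real.pi * r) * g r := by
  let μ : Measure Plane := volume
  have hdim : Module.finrank ℝ Plane = 2 := by simp
  have hgs : Measurable fun r : Ioi (0 : ℝ) => g r := hg.comp measurable_subtype_coe
  calc ∫⁻ x : Plane, g ‖x‖
      = ∫⁻ x : ({(0)}ᶜ : Set Plane), g ‖x.1‖ ∂(μ.comap (↑)) := by
        rw [lintegral_subtype_comap (measurableSet_singleton _).compl fun x => g ‖x‖,
          restrict_compl_singleton]
    _ = ∫⁻ x, g x.2 ∂(μ.toSphere.prod (.volumeIoiPow (Module.finrank ℝ Plane - 1))) := by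
        simpa using μ.measurePreserving_homeomorphUnitSphereProd.lintegral_comp_emb
          (Homeomorph.measurableEmbedding _)
          (fun x : Metric.sphere (0 : Plane) 1 × Ioi (0 : ℝ) => g x.2)
    _ = ENNReal.ofReal (2 * Real.pi) *
          ∫⁻ r : Ioi (0 : ℝ), g r ∂(.volumeIoiPow (Module.finrank ℝ Plane - 1)) := by
        have hgs2 : Measurable fun x : Metric.sphere (0 : Plane) 1 × Ioi (0 : ℝ) => g x.2 :=
          hgs.comp measurable_snd
        rw [lintegral_prod _ hgs2.aemeasurable]
        simp only [lintegral_const]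
        rw [mul_comm, μ.toSphere_apply_univ, hdim, EuclideanSpace.volume_ball_fin_two,
          ENNReal.ofReal_mul zero_le_two]
        simp
    _ = ENNReal.ofReal (2 * Real.pi) * ∫⁻ r in Ioi (0 : ℝ), ENNReal.ofReal r * g r := by
        rw [Measure.volumeIoiPow, lintegral_withDensity_eq_lintegral_mul _ (by fun_prop) hgs, hdim]
        simp only [Pi.mul_apply, Nat.add_one_sub_one, pow_one]
        rw [lintegral_subtype_comap measurableSet_Ioi fun r => ENNReal.ofReal r * g r]
    _ = ∫⁻ r in Ioi (0 : ℝ), ENNReal.ofReal (2 * Real.pi * r) * g r := by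
        rw [← lintegral_const_mul' _ _ ENNReal.ofReal_ne_top]
        refine lintegral_congr fun r => ?_
        rw [← mul_assoc, ← ENNReal.ofReal_mul (by positivity)]

/-- The substitution `r = a v ^ (-(δ / 2))`, under which `2π r dr` becomes `π a² δ v ^ (-δ - 1) dv`
up to orientation. With `δ = 2 / α` it reads `v = (a / r) ^ α`, so the exponent scales with `a²`. -/
lemma lintegral_mul_comp_rpow {δ a : ℝ} (hδ : 0 < δ) (ha : 0 < a) (g : ℝ → ℝ≥0∞) :
    ∫⁻ r in Ioi (0 : ℝ), ENNReal.ofReal (2 * Real.pi * r) * g r =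
      ENNReal.ofReal (Real.pi * a ^ 2) *
        ∫⁻ v in Ioi (0 : ℝ), ENNReal.ofReal (δ * v ^ (-δ - 1)) * g (a * v ^ (-(δ / 2))) := by
  have himage : (fun v : ℝ => a * v ^ (-(δ / 2))) '' Ioi 0 = Ioi 0 := by
    ext r
    constructor
    · rintro ⟨v, hv, rfl⟩
      exact mul_pos ha (Real.rpow_pos_of_pos hv _)
    · intro hr
      have hr0 : 0 < r := hr
      refine ⟨(r / a) ^ (-(2 / δ)), Real.rpow_pos_of_pos (by positivity) _, ?_⟩
      dsimp only
      rw [← Real.rpow_mul (by positivity), show -(2 / δ) * -(δ / 2) = 1 by field_simp,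
        Real.rpow_one, mul_div_cancel₀ _ ha.ne']
  have hinj : InjOn (fun v : ℝ => a * v ^ (-(δ / 2))) (Ioi 0) := fun v hv w hw hvw => by
    have h1 : v ^ (-(δ / 2)) = w ^ (-(δ / 2)) := mul_left_cancel₀ ha.ne' hvw
    exact (Real.rpow_left_inj (mem_Ioi.1 hv).le (mem_Ioi.1 hw).le (by linarith)).1 h1
  have hderiv : ∀ v ∈ Ioi (0 : ℝ), HasDerivWithinAt (fun v : ℝ => a * v ^ (-(δ / 2)))
      (a * (-(δ / 2) * v ^ (-(δ / 2) - 1))) (Ioi 0) v := fun v hv =>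
    ((Real.hasDerivAt_rpow_const (Or.inl (mem_Ioi.1 hv).ne')).const_mul a).hasDerivWithinAt
  have h := lintegral_image_eq_lintegral_abs_deriv_mul measurableSet_Ioi hderiv hinj
    fun r => ENNReal.ofReal (2 * Real.pi * r) * g r
  rw [himage] at h
  rw [h, ← lintegral_const_mul' _ _ ENNReal.ofReal_ne_top]
  refine setLIntegral_congr_fun measurableSet_Ioi fun v hv => ?_
  have hv0 : 0 < v := hv
  have hr1 : 0 < v ^ (-(δ / 2) - 1) := Real.rpow_pos_of_pos hv0 _
  have hr2 : 0 < v ^ (-(δ / 2)) := Real.rpow_pos_of_pos hv0 _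
  have habs : |a * (-(δ / 2) * v ^ (-(δ / 2) - 1))| = a * (δ / 2 * v ^ (-(δ / 2) - 1)) := by
    rw [neg_mul, mul_neg, abs_neg, abs_of_pos (by positivity)]
  have hpow : v ^ (-δ - 1) = v ^ (-(δ / 2) - 1) * v ^ (-(δ / 2)) := by
    rw [← Real.rpow_add hv0]
    congr 1
    ring
  rw [habs, ← mul_assoc (ENNReal.ofReal _) (ENNReal.ofReal _),
    ← mul_assoc (ENNReal.ofReal _) (ENNReal.ofReal _), ← ENNReal.ofReal_mul (by positivity),
    ← ENNReal.ofReal_mul (by positivity), hpow]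
  congr 2
  ring

/-! ### The exponent of the interference field -/

/-- The logarithmic cost that a station at distance `b` imposes on the coverage by the station at
distance `a`: a nearer station must not store the file, and its signal interferes. -/
noncomputable def stationCost (α p τ a b : ℝ) : ℝ≥0∞ :=
  (if b < a then negLog (ENNReal.ofReal (1 - p)) else 0) +
    ENNReal.ofReal (Real.log (1 + τ * a ^ α * b ^ (-α)))

section StationCost

variable {α p τ : ℝ}

lemma negExp_stationCost (hτ : 0 ≤ τ) (hp0 : 0 ≤ p) {a b : ℝ} (ha : 0 ≤ a) (hb : 0 ≤ b) :
    negExp (stationCost α p τ a b) =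
      ENNReal.ofReal ((if b < a then 1 - p else 1) * (1 + τ * a ^ α * b ^ (-α))⁻¹) := by
  have h1 : 0 ≤ τ * a ^ α * b ^ (-α) :=
    mul_nonneg (mul_nonneg hτ (Real.rpow_nonneg ha _)) (Real.rpow_nonneg hb _)
  have hlog : 0 ≤ Real.log (1 + τ * a ^ α * b ^ (-α)) := Real.log_nonneg (by linarith)
  rw [stationCost, negExp_add, negExp_ofReal hlog, Real.exp_neg, Real.exp_log (by linarith),
    ENNReal.ofReal_mul' (inv_nonneg.2 (by linarith))]
  congr 1
  split_ifs
  · exact negExp_negLog (by rw [← ENNReal.ofReal_one]; exact ENNReal.ofReal_le_ofReal (by linarith))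
  · simp

lemma measurable_stationCost : Measurable (Function.uncurry (stationCost α p τ)) := by
  refine Measurable.add ?_ ?_
  · exact Measurable.ite (measurableSet_lt measurable_snd measurable_fst) measurable_const
      measurable_const
  · exact (Real.measurable_log.comp (by fun_prop)).ennreal_ofReal

lemma monotoneOn_stationCost (hα : 0 < α) (hτ : 0 ≤ τ) {b : ℝ} (hb : 0 ≤ b) :
    MonotoneOn (fun a => stationCost α p τ a b) (Ici 0) := by
  intro a ha a' ha' h
  have ha0 : 0 ≤ a := ha
  have hb' := Real.rpow_nonneg hb (-α)
  refine add_le_add ?_ (ENNReal.ofReal_le_ofReal (Real.log_le_log ?_ ?_))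
  · split_ifs with h1 h2
    · exact le_rfl
    · exact absurd (h1.trans_le h) h2
    · exact zero_le
    · exact le_rfl
  · have := mul_nonneg (mul_nonneg hτ (Real.rpow_nonneg ha0 α)) hb'
    linarith
  · gcongr

/-- Only left continuity in `a` holds in general, because the cache term jumps as `a` passes `b`.
The strict inequality `b < a` makes the jump occur just after `a = b`, as approximation from below
requires. -/
lemma continuousWithinAt_stationCost (hα : 0 < α) (hτ : 0 ≤ τ) {a b : ℝ} (ha : 0 ≤ a)
    (hb : 0 ≤ b) : ContinuousWithinAt (fun a => stationCost α p τ a b) (Icc 0 a) a := by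
  refine ContinuousWithinAt.add ?_ ?_
  · by_cases h : b < a
    · refine (continuousAt_const (y := negLog (ENNReal.ofReal (1 - p)))).continuousWithinAt.congr_of_eventuallyEq
        ?_ (if_pos h)
      filter_upwards [mem_nhdsWithin_of_mem_nhds (lt_mem_nhds h)] with x hx using if_pos hx
    · refine (continuousWithinAt_const (b := (0 : ℝ≥0∞))).congr (fun x hx => if_neg ?_) (if_neg h)
      exact fun hbx => h (hbx.trans_le hx.2)
  · refine ENNReal.continuous_ofReal.continuousAt.comp_continuousWithinAt
      (ContinuousAt.continuousWithinAt (ContinuousAt.log ?_ ?_))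
    · exact continuousAt_const.add ((continuousAt_const.mul
        (Real.continuousAt_rpow_const a α (Or.inr hα.le))).mul continuousAt_const)
    · have := mul_nonneg (mul_nonneg hτ (Real.rpow_nonneg ha α)) (Real.rpow_nonneg hb (-α))
      positivity

/-- The intensity of the interference field, in the Laplace functional. -/
lemma lintegral_one_sub_negExp_stationCost (hα : 2 < α) (hτ : 0 ≤ τ) (hp0 : 0 ≤ p) (hp1 : p ≤ 1)
    {a : ℝ} (ha : 0 < a) :
    ∫⁻ y : Plane, (1 - negExp (stationCost α p τ a ‖y‖)) =
      ENNReal.ofReal (Real.pi * a ^ 2 * (p * hyperS 0 1 α τ + (1 - p) * gammaDelta 1 α τ)) := by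
  have hα0 : 0 < α := by linarith
  have hδ : 0 < 2 / α := by positivity
  have hm : Measurable fun b => 1 - negExp (stationCost α p τ a b) :=
    (measurable_negExp.comp (measurable_stationCost.comp measurable_prodMk_left)).const_sub 1
  rw [lintegral_comp_norm_plane hm, lintegral_mul_comp_rpow hδ ha,
    ENNReal.ofReal_mul (p := Real.pi * a ^ 2) (by positivity), ← lintegral_radial_exponent hα hτ hp0 hp1]
  congr 1
  refine setLIntegral_congr_fun measurableSet_Ioi fun v hv => ?_
  have hv0 : 0 < v := hv
  have hr : 0 < v ^ (-(2 / α / 2)) := Real.rpow_pos_of_pos hv0 _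
  -- In the new variable, the relative interference is `v` itself, and a station is nearer exactly
  -- when `1 < v`.
  have hpow : a ^ α * (a * v ^ (-(2 / α / 2))) ^ (-α) = v := by
    rw [Real.mul_rpow ha.le hr.le, ← Real.rpow_mul hv0.le, ← mul_assoc, ← Real.rpow_add ha,
      add_neg_cancel, Real.rpow_zero, one_mul, show -(2 / α / 2) * -α = 1 by field_simp,
      Real.rpow_one]
  have hlt : a * v ^ (-(2 / α / 2)) < a ↔ 1 < v := by
    rw [mul_lt_iff_lt_one_right ha, Real.rpow_lt_one_iff_of_pos hv0]
    constructor
    · rintro (⟨h, _⟩ | ⟨_, h⟩)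
      · exact h
      · linarith
    · exact fun h => Or.inl ⟨h, by linarith⟩
  have hq0 : 0 ≤ if 1 < v then 1 - p else 1 := by split_ifs <;> linarith
  have hq : (if 1 < v then 1 - p else 1) * (1 + τ * v)⁻¹ ≤ 1 := by
    refine mul_le_one₀ ?_ (inv_nonneg.2 (by positivity)) (inv_le_one_of_one_le₀ ?_)
    · split_ifs <;> linarith
    · have := mul_nonneg hτ hv0.le
      linarith
  rw [negExp_stationCost hτ hp0 ha.le (by positivity), mul_assoc τ, hpow,
    ← ENNReal.ofReal_one, ← ENNReal.ofReal_sub _ (by positivity),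
    ← ENNReal.ofReal_mul (mul_nonneg hδ.le (Real.rpow_nonneg hv0.le _))]
  simp only [hlt]

end StationCost

/-! ### The coverage probability -/

lemma pathLoss_nonneg {C : ℝ} (hC : 0 ≤ C) (α : ℝ) {r : ℝ} (hr : 0 ≤ r) : 0 ≤ pathLoss C α r :=
  mul_nonneg hC (Real.rpow_nonneg hr _)

lemma measurableSet_stores {Nc : ℕ} (f : Fin Nc) :
    MeasurableSet {c : Fin Nc → Bool | c f = true} := by
  have h : Measurable fun c : Fin Nc → Bool => c f := measurable_pi_apply f
  exact h (measurableSet_singleton true)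

section Tier

variable {Ω : Type*} {Nc : ℕ} {X : ℕ → Ω → Plane} {cache : ℕ → Ω → Fin Nc → Bool}
  {h : ℕ → Ω → ℂ} {f : Fin Nc}

/-- When the serving station stores the file, both kinds of interference add up to the power
received from all other stations. -/
lemma interferenceCaching_add_interferenceNonCaching (P C α : ℝ) (N : ℕ) {k : ℕ} {ω : Ω}
    (hk : cache k ω f = true) :
    interferenceCaching P C α N X cache h f k ω + interferenceNonCaching P C α N X cache h f ω =
      ∑' j, if j = k then 0 else ENNReal.ofReal (interferingPower P C α N X h j ω) := by
  rw [interferenceCaching, interferenceNonCaching, ← ENNReal.tsum_add]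
  refine tsum_congr fun j => ?_
  by_cases hj : j = k
  · subst hj; simp [hk]
  · cases hc : cache j ω f <;> simp [hj]

variable [MeasurableSpace Ω]

lemma measurable_sinr (hX : ∀ k, Measurable (X k)) (hc : ∀ k, Measurable (cache k))
    (hh : ∀ k, Measurable (h k)) (P C α σ : ℝ) (N : ℕ) (k : ℕ) :
    Measurable (sinr P C α σ N X cache h f k) := by
  have hpow : ∀ j, Measurable (interferingPower P C α N X h j) := fun j => by
    have h1 := hX j
    have h2 := hh j
    unfold interferingPower pathLoss
    fun_prop
  have hcf : ∀ j, Measurable fun ω => cache j ω f := fun j => (measurable_pi_apply f).comp (hc j)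
  have hA : Measurable (interferenceCaching P C α N X cache h f k) := by
    refine Measurable.tsum fun j => ?_
    by_cases hj : j = k
    · simp [hj]
    · simp only [hj, ne_eq, not_false_eq_true, and_true]
      exact Measurable.ite ((hcf j) (measurableSet_singleton true)) (hpow j).ennreal_ofReal
        measurable_const
  have hB : Measurable (interferenceNonCaching P C α N X cache h f) :=
    Measurable.tsum fun j => Measurable.ite ((hcf j) (measurableSet_singleton false))
      (hpow j).ennreal_ofReal measurable_const
  have h1 := hX k
  have h2 := hh k
  unfold sinr pathLoss
  fun_prop

lemma measurableSet_isServing (hX : ∀ k, Measurable (X k)) (hc : ∀ k, Measurable (cache k))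
    (k : ℕ) : MeasurableSet {ω | IsServing X cache f k ω} := by
  have hcf : ∀ j, MeasurableSet {ω | cache j ω f = true} := fun j =>
    ((measurable_pi_apply f).comp (hc j)) (measurableSet_singleton true)
  have : {ω | IsServing X cache f k ω} = {ω | cache k ω f = true} ∩
      ⋂ j, ({ω | cache j ω f = true}ᶜ ∪ {ω | ‖X k ω‖ ≤ ‖X j ω‖}) := by
    ext ω
    simp only [IsServing, mem_inter_iff, mem_iInter, mem_union, mem_compl_iff]
    exact and_congr Iff.rfl (forall_congr' fun j => imp_iff_not_or)
  rw [this]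
  exact (hcf k).inter (MeasurableSet.iInter fun j => (hcf j).compl.union
    (measurableSet_le (hX k).norm (hX j).norm))

lemma measurableSet_isServing_and_lt_sinr (hX : ∀ k, Measurable (X k))
    (hc : ∀ k, Measurable (cache k)) (hh : ∀ k, Measurable (h k)) (P C α σ : ℝ) (N : ℕ) (k : ℕ)
    (τ : ℝ) : MeasurableSet {ω | IsServing X cache f k ω ∧
      ENNReal.ofReal τ < sinr P C α σ N X cache h f k ω} :=
  (measurableSet_isServing hX hc k).inter
    (measurableSet_lt measurable_const (measurable_sinr hX hc hh P C α σ N k))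

variable {μ : Measure Ω} {ν : Measure (Fin Nc → Bool)} {lam : ℝ}

lemma cacheProb_nonneg : 0 ≤ cacheProb ν f := measureReal_nonneg

lemma cacheProb_le_one [IsProbabilityMeasure ν] : cacheProb ν f ≤ 1 := measureReal_le_one

namespace IsMacroTier

lemma measureReal_cache (htier : IsMacroTier μ lam ν X cache h) (k : ℕ) :
    μ.real {ω | cache k ω ∈ {c : Fin Nc → Bool | c f = true}} = cacheProb ν f := by
  rw [cacheProb, ← (htier.cache_law k).map_eq,
    map_measureReal_apply (htier.measurable_cache k) (measurableSet_stores f)]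
  rfl

/-- The probability that the user is served by a given station and covered, for fixed locations of
the stations. -/
lemma measure_isServing_and_lt_sinr_const [IsProbabilityMeasure μ]
    (htier : IsMacroTier μ lam ν X cache h) {P C α : ℝ} (σ : ℝ) {N : ℕ} (hP : 0 < P) (hC : 0 < C)
    (hN : 0 < N) {τ : ℝ} (hτ : 0 ≤ τ) {x : ℕ → Plane} {k : ℕ} (hx : x k ≠ 0)
    (hfin : ∑' j, ENNReal.ofReal (‖x j‖ ^ (-α)) ≠ ⊤) :
    μ {ω | IsServing (fun j _ => x j) cache f k ω ∧
        ENNReal.ofReal τ < sinr P C α σ N (fun j _ => x j) cache h f k ω} =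
      ENNReal.ofReal (cacheProb ν f) *
        negExp (ENNReal.ofReal (τ * σ ^ 2 * ‖x k‖ ^ α / (P * C * N * servingGain))) *
        negExp (∑' j, if j = k then 0 else stationCost α (cacheProb ν f) τ ‖x k‖ ‖x j‖) := by
  have hr : 0 < ‖x k‖ := norm_pos_iff.2 hx
  have hNR : (0 : ℝ) < N := by exact_mod_cast hN
  let a : ℝ := P * pathLoss C α ‖x k‖ * servingGain * N
  let t : ℕ → ℝ := fun j => P * pathLoss C α ‖x j‖ * N
  have hrα : 0 < ‖x k‖ ^ (-α) := Real.rpow_pos_of_pos hr _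
  have ha : 0 < a := by
    have : a = P * (C * ‖x k‖ ^ (-α)) * N := by simp [a, pathLoss, servingGain]
    rw [this]; positivity
  have ht : ∀ j, 0 ≤ t j := fun j => by
    have := pathLoss_nonneg hC.le α (norm_nonneg (x j))
    positivity
  have htfin : ∑' j, ENNReal.ofReal (t j) ≠ ⊤ := by
    have : ∀ j, ENNReal.ofReal (t j) = ENNReal.ofReal (P * C * N) *
        ENNReal.ofReal (‖x j‖ ^ (-α)) := fun j => by
      rw [← ENNReal.ofReal_mul (by positivity)]
      congr 1
      simp only [t, pathLoss]
      ring
    simp_rw [this]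
    rw [ENNReal.tsum_mul_left]
    exact ENNReal.mul_ne_top ENNReal.ofReal_ne_top hfin
  have hratio : ∀ j, τ / a * t j = τ * ‖x k‖ ^ α * ‖x j‖ ^ (-α) := fun j => by
    have : ‖x k‖ ^ (-α) = (‖x k‖ ^ α)⁻¹ := Real.rpow_neg hr.le α
    have h0 : 0 < ‖x k‖ ^ α := Real.rpow_pos_of_pos hr _
    simp only [a, t, pathLoss, servingGain, this]
    field_simp
  have hnoise : ENNReal.ofReal (τ / a) * ENNReal.ofReal (σ ^ 2) =
      ENNReal.ofReal (τ * σ ^ 2 * ‖x k‖ ^ α / (P * C * N * servingGain)) := by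
    rw [← ENNReal.ofReal_mul (by positivity)]
    congr 1
    have : ‖x k‖ ^ (-α) = (‖x k‖ ^ α)⁻¹ := Real.rpow_neg hr.le α
    have h0 : 0 < ‖x k‖ ^ α := Real.rpow_pos_of_pos hr _
    simp only [a, pathLoss, servingGain, this]
    field_simp
  let S : Set (ℕ → Fin Nc → Bool) := {c | IsServing (fun j _ => x j) (fun j c => c j) f k c}
  let T : Set (ℕ → ℂ) := {g | ENNReal.ofReal τ < ENNReal.ofReal (a * ‖g k‖ ^ 2) /
    (ENNReal.ofReal (σ ^ 2) + ∑' j, if j = k then 0 else ENNReal.ofReal (t j * ‖g j‖ ^ 2))}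
  have hS : MeasurableSet S :=
    measurableSet_isServing (fun j => measurable_const) (fun j => measurable_pi_apply j) k
  have hT : MeasurableSet T := by
    have hI : Measurable fun g : ℕ → ℂ =>
        ∑' j, if j = k then 0 else ENNReal.ofReal (t j * ‖g j‖ ^ 2) :=
      measurable_tsum_ite_ofReal_mul (Z := fun j (g : ℕ → ℂ) => ‖g j‖ ^ 2)
        (fun j _ => by fun_prop) t
    exact measurableSet_lt measurable_const (by fun_prop)
  -- With the locations fixed, serving is an event of the caches and, given that station `k` stores
  -- the file, the SINR condition is an event of the fading alone; so the probability factors.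
  have hevent : {ω | IsServing (fun j _ => x j) cache f k ω ∧
      ENNReal.ofReal τ < sinr P C α σ N (fun j _ => x j) cache h f k ω} =
      (fun ω k => cache k ω) ⁻¹' S ∩ (fun ω k => h k ω) ⁻¹' T := by
    ext ω
    refine and_congr_right fun hserv => ?_
    rw [sinr, add_assoc, interferenceCaching_add_interferenceNonCaching P C α N hserv.1]
    have : ∀ j, interferingPower P C α N (fun j (_ : Ω) => x j) h j ω = t j * ‖h j ω‖ ^ 2 :=
      fun j => by simp only [interferingPower, omniGain, t]; ring
    simp_rw [this]
    exact Iff.rfl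
  have hind := htier.indep_cache_fading.measure_inter_preimage_eq_mul S T hS hT
  have hcache : μ ((fun ω k => cache k ω) ⁻¹' S) = ENNReal.ofReal (cacheProb ν f) *
      negExp (∑' j, if j = k then 0 else if ‖x j‖ < ‖x k‖ then
        negLog (ENNReal.ofReal (1 - cacheProb ν f)) else 0) := by
    rw [← measure_and_forall_not_of_iIndepFun htier.measurable_cache htier.cache_indep
      (measurableSet_stores f)
      htier.measureReal_cache k (fun j => ‖x j‖ < ‖x k‖) (lt_irrefl _)]
    congr 1
    ext ω
    simp only [not_lt]
    exact Iff.rfl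
  have hfading : μ ((fun ω k => h k ω) ⁻¹' T) =
      negExp (ENNReal.ofReal (τ * σ ^ 2 * ‖x k‖ ^ α / (P * C * N * servingGain))) *
        negExp (∑' j, if j = k then 0 else
          ENNReal.ofReal (Real.log (1 + τ * ‖x k‖ ^ α * ‖x j‖ ^ (-α)))) := by
    have hmeas : ∀ j, Measurable fun ω => ‖h j ω‖ ^ 2 := fun j =>
      (htier.measurable_fading j).norm.pow_const 2
    have h1 := measure_lt_div_of_iIndepFun hmeas
      (htier.fading_indep.comp (fun _ z => ‖z‖ ^ 2) fun _ => by fun_prop) htier.fading_law k ha hτ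
      (D := ENNReal.ofReal (σ ^ 2)) ENNReal.ofReal_ne_top ht htfin
    simp_rw [hratio, hnoise] at h1
    exact h1
  have hcost : (∑' j, if j = k then 0 else stationCost α (cacheProb ν f) τ ‖x k‖ ‖x j‖) =
      (∑' j, if j = k then 0 else if ‖x j‖ < ‖x k‖ then
        negLog (ENNReal.ofReal (1 - cacheProb ν f)) else 0) +
      ∑' j, if j = k then 0 else
        ENNReal.ofReal (Real.log (1 + τ * ‖x k‖ ^ α * ‖x j‖ ^ (-α))) := by
    rw [← ENNReal.tsum_add]
    refine tsum_congr fun j => ?_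
    split_ifs <;> simp [stationCost, *]
  rw [hevent, hind, hcache, hfading, hcost, negExp_add]
  ring

end IsMacroTier
end Tier

/-! ### From fixed to random locations -/

instance (lam : ℝ) : SigmaFinite (ENNReal.ofReal lam • (volume : Measure Plane)) :=
  inferInstanceAs (SigmaFinite (lam.toNNReal • (volume : Measure Plane)))

namespace IsMacroTier

variable {Ω : Type*} {Nc : ℕ} {X : ℕ → Ω → Plane} {cache : ℕ → Ω → Fin Nc → Bool}
  {h : ℕ → Ω → ℂ} {f : Fin Nc} [MeasurableSpace Ω] {μ : Measure Ω} {ν : Measure (Fin Nc → Bool)}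
  {lam : ℝ}

/-- A single point has zero intensity. The case must be excluded because `0 ^ (-α)` is `0` by
convention, so a serving station at the origin would have no signal. -/
lemma ae_location_ne_zero [IsProbabilityMeasure μ] (htier : IsMacroTier μ lam ν X cache h) :
    ∀ᵐ ω ∂μ, ∀ k, X k ω ≠ 0 := by
  refine ae_all_iff.2 fun k => ?_
  have hm : Measurable (({0} : Set Plane).indicator (1 : Plane → ℝ≥0∞)) :=
    measurable_one.indicator (measurableSet_singleton 0)
  have hk : Measurable fun ω => ({0} : Set Plane).indicator (1 : Plane → ℝ≥0∞) (X k ω) :=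
    hm.comp (htier.measurable_location k)
  have h1 := htier.poisson.tsum_lintegral htier.measurable_location hm
  rw [lintegral_indicator_one (measurableSet_singleton 0), Measure.smul_apply, measure_singleton,
    smul_zero] at h1
  have h2 := ENNReal.tsum_eq_zero.1 h1 k
  rw [lintegral_eq_zero_iff hk] at h2
  filter_upwards [h2] with ω hω h0
  simp [h0] at hω

/-- Circles are null sets. Without ties there is at most one serving station. -/
lemma ae_norm_ne_norm [IsProbabilityMeasure μ] (htier : IsMacroTier μ lam ν X cache h) :
    ∀ᵐ ω ∂μ, ∀ k j, j ≠ k → ‖X j ω‖ ≠ ‖X k ω‖ := by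
  refine htier.poisson.ae_forall_ne htier.measurable_location measurable_norm norm_nonneg
    (fun a => ?_) fun R => ?_
  · have : {y : Plane | ‖y‖ = a} = Metric.sphere 0 a := by ext; simp
    rw [this, Measure.smul_apply, Measure.addHaar_sphere, smul_zero]
  · have : {y : Plane | ‖y‖ ≤ R} = Metric.closedBall 0 R := by ext; simp
    rw [this, Measure.smul_apply, smul_eq_mul]
    exact ENNReal.mul_ne_top ENNReal.ofReal_ne_top measure_closedBall_lt_top.ne

/-- The mean interference is almost surely finite. -/
lemma ae_tsum_rpow_ne_top [IsProbabilityMeasure μ] (htier : IsMacroTier μ lam ν X cache h) {α : ℝ}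
    (hα : 2 < α) : ∀ᵐ ω ∂μ, ∑' k, ENNReal.ofReal (‖X k ω‖ ^ (-α)) ≠ ⊤ := by
  refine htier.poisson.ae_tsum_ne_top htier.measurable_location
    (w := fun x => ENNReal.ofReal (‖x‖ ^ (-α))) (by fun_prop) (fun _ => ENNReal.ofReal_ne_top)
    (A := Metric.closedBall 0 1) measurableSet_closedBall ?_ ?_
  · rw [Measure.smul_apply, smul_eq_mul]
    exact ENNReal.mul_ne_top ENNReal.ofReal_ne_top measure_closedBall_lt_top.ne
  · let g : ℝ → ℝ≥0∞ := (Ioi 1).indicator fun r => ENNReal.ofReal (r ^ (-α))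
    have hg : Measurable g := Measurable.indicator (by fun_prop) measurableSet_Ioi
    have hgx : ∀ x : Plane, (Metric.closedBall (0 : Plane) 1)ᶜ.indicator
        (fun x => ENNReal.ofReal (‖x‖ ^ (-α))) x = g ‖x‖ := fun x => by
      by_cases hx : 1 < ‖x‖ <;> simp [g, hx]
    -- The planar Jacobian leaves `r ^ (1 - α)`, which is integrable at infinity because `2 < α`.
    have hint : ∫⁻ r in Ioi (0 : ℝ), ENNReal.ofReal (2 * Real.pi * r) * g r =
        ∫⁻ r in Ioi (1 : ℝ), ENNReal.ofReal (2 * Real.pi * r ^ (1 - α)) := by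
      rw [← inter_eq_left.2 (Ioi_subset_Ioi (zero_le_one (α := ℝ))),
        ← setLIntegral_indicator measurableSet_Ioi]
      refine lintegral_congr fun r => ?_
      by_cases hr : 1 < r
      · have hr0 : 0 < r := by linarith
        rw [indicator_of_mem (show r ∈ Ioi (1 : ℝ) from hr),
          show g r = ENNReal.ofReal (r ^ (-α)) from indicator_of_mem (show r ∈ Ioi (1 : ℝ) from hr) _,
          ← ENNReal.ofReal_mul (by positivity), sub_eq_add_neg, Real.rpow_add hr0, Real.rpow_one,
          mul_assoc]
      · rw [indicator_of_notMem (show r ∉ Ioi (1 : ℝ) from hr),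
          show g r = 0 from indicator_of_notMem (show r ∉ Ioi (1 : ℝ) from hr) _, mul_zero]
    rw [Measure.restrict_smul, lintegral_smul_measure,
      ← lintegral_indicator measurableSet_closedBall.compl, lintegral_congr hgx,
      lintegral_comp_norm_plane hg, hint, smul_eq_mul]
    exact ENNReal.mul_ne_top ENNReal.ofReal_ne_top
      ((integrableOn_Ioi_rpow_of_lt (by linarith) one_pos).const_mul _).lintegral_lt_top.ne

/-- The coverage probability as a sum over the stations. -/
lemma measure_exists_isServing_and_lt_sinr [IsProbabilityMeasure μ] [IsProbabilityMeasure ν]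
    (htier : IsMacroTier μ lam ν X cache h) {P C α : ℝ} (σ : ℝ) {N : ℕ} (hP : 0 < P) (hC : 0 < C)
    (hα : 2 < α) (hN : 0 < N) {τ : ℝ} (hτ : 0 ≤ τ) :
    μ {ω | ∃ k, IsServing X cache f k ω ∧ ENNReal.ofReal τ < sinr P C α σ N X cache h f k ω} =
      ∑' k, ∫⁻ ω, ENNReal.ofReal (cacheProb ν f) *
        negExp (ENNReal.ofReal (τ * σ ^ 2 * ‖X k ω‖ ^ α / (P * C * N * servingGain))) *
        negExp (∑' j, if j = k then 0 else
          stationCost α (cacheProb ν f) τ ‖X k ω‖ ‖X j ω‖) ∂μ := by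
  have hmeas : ∀ k, MeasurableSet {ω | IsServing X cache f k ω ∧
      ENNReal.ofReal τ < sinr P C α σ N X cache h f k ω} := fun k =>
    measurableSet_isServing_and_lt_sinr htier.measurable_location htier.measurable_cache
      htier.measurable_fading P C α σ N k τ
  have hunion : {ω | ∃ k, IsServing X cache f k ω ∧
      ENNReal.ofReal τ < sinr P C α σ N X cache h f k ω} =
      ⋃ k, {ω | IsServing X cache f k ω ∧ ENNReal.ofReal τ < sinr P C α σ N X cache h f k ω} := by
    ext ω
    rw [mem_iUnion]
    rfl
  have hdisj : Pairwise (Function.onFun (AEDisjoint μ) fun k => {ω | IsServing X cache f k ω ∧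
      ENNReal.ofReal τ < sinr P C α σ N X cache h f k ω}) := fun k j hkj => by
    refine measure_mono_null (fun ω hω => ?_) (ae_iff.1 htier.ae_norm_ne_norm)
    intro hne
    exact hne k j hkj.symm (le_antisymm (hω.2.1.2 k hω.1.1.1) (hω.1.1.2 j hω.2.1.1))
  rw [hunion, measure_iUnion₀ hdisj fun k => (hmeas k).nullMeasurableSet]
  refine tsum_congr fun k => ?_
  let U : Ω → ℕ → Plane := fun ω j => X j ω
  let V : Ω → (ℕ → Fin Nc → Bool) × (ℕ → ℂ) := fun ω => (fun j => cache j ω, fun j => h j ω)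
  have hU : Measurable U := measurable_pi_lambda _ htier.measurable_location
  have hV : Measurable V := (measurable_pi_lambda _ htier.measurable_cache).prodMk
    (measurable_pi_lambda _ htier.measurable_fading)
  let S : Set ((ℕ → Plane) × ((ℕ → Fin Nc → Bool) × (ℕ → ℂ))) :=
    {q | IsServing (fun j q => q.1 j) (fun j q => q.2.1 j) f k q ∧ ENNReal.ofReal τ <
      sinr P C α σ N (fun j q => q.1 j) (fun j q => q.2.1 j) (fun j q => q.2.2 j) f k q}
  have hS : MeasurableSet S := measurableSet_isServing_and_lt_sinr
    (fun j => (measurable_pi_apply j).comp measurable_fst)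
    (fun j => (measurable_pi_apply j).comp (measurable_fst.comp measurable_snd))
    (fun j => (measurable_pi_apply j).comp (measurable_snd.comp measurable_snd)) P C α σ N k τ
  -- Locations are independent of the marks, so they may be frozen and the formula for fixed
  -- locations integrated over them.
  have hfub := measure_prodMk_mem_of_indepFun hU hV htier.indep_location_marks hS
  refine hfub.trans (lintegral_congr_ae ?_)
  filter_upwards [htier.ae_location_ne_zero, htier.ae_tsum_rpow_ne_top hα] with ω h0 hfin
  exact htier.measure_isServing_and_lt_sinr_const σ hP hC hN hτ (x := fun j => X j ω) (h0 k) hfin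

/-- The coverage formula with values in `[0, ∞]`. -/
lemma measure_coverage_eq_lintegral [IsProbabilityMeasure μ] [IsProbabilityMeasure ν]
    (htier : IsMacroTier μ lam ν X cache h) {P C α : ℝ} (σ : ℝ) {N : ℕ} (hP : 0 < P) (hC : 0 < C)
    (hα : 2 < α) (hlam : 0 < lam) (hN : 0 < N) {τ : ℝ} (hτ : 0 ≤ τ) :
    μ {ω | ∃ k, IsServing X cache f k ω ∧ ENNReal.ofReal τ < sinr P C α σ N X cache h f k ω} =
      ∫⁻ r in Ioi (0 : ℝ),
        ENNReal.ofReal (coverageIntegrand P C α σ lam (cacheProb ν f) τ N r) := by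
  set p := cacheProb ν f with hp
  have hp0 : 0 ≤ p := cacheProb_nonneg
  have hp1 : p ≤ 1 := cacheProb_le_one
  have hα0 : 0 < α := by linarith
  have hNR : (0 : ℝ) < N := by exact_mod_cast hN
  have hG : (0 : ℝ) < servingGain := one_pos
  let w : ℝ → ℝ≥0∞ := fun r =>
    ENNReal.ofReal p * negExp (ENNReal.ofReal (τ * σ ^ 2 * r ^ α / (P * C * N * servingGain)))
  let L : ℝ → ℝ≥0∞ := fun a =>
    negExp (∫⁻ y : Plane, (1 - negExp (stationCost α p τ a ‖y‖)) ∂(ENNReal.ofReal lam • volume))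
  have hw : Measurable w := by fun_prop
  have hw1 : ∀ x : Plane, w ‖x‖ ≤ 1 := fun x =>
    mul_le_one' (by rw [← ENNReal.ofReal_one]; exact ENNReal.ofReal_le_ofReal hp1) (negExp_le_one _)
  have hcost : Measurable fun q : ℝ × Plane => stationCost α p τ q.1 ‖q.2‖ :=
    measurable_stationCost.comp (measurable_fst.prodMk measurable_snd.norm)
  have hL : Measurable L := measurable_negExp.comp (Measurable.lintegral_prod_right
    (f := fun a (y : Plane) => 1 - negExp (stationCost α p τ a ‖y‖))
    ((measurable_negExp.comp hcost).const_sub 1))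
  -- The weight `w` carries the cache probability of the server and the noise factor; the costs of
  -- the other stations depend on the server only through its distance.
  have hmecke := htier.poisson.tsum_lintegral_mul_negExp_mono htier.measurable_location
    measurable_norm norm_nonneg (f := fun a (y : Plane) => stationCost α p τ a ‖y‖) hcost
    (fun y => monotoneOn_stationCost hα0 hτ (norm_nonneg y))
    (fun y a ha => continuousWithinAt_stationCost hα0 hτ ha (norm_nonneg y))
    (w := fun x => w ‖x‖) (hw.comp measurable_norm) hw1
  rw [htier.measure_exists_isServing_and_lt_sinr σ hP hC hα hN hτ, ← hp]
  refine hmecke.trans ?_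
  rw [lintegral_smul_measure, smul_eq_mul]
  have hpolar := lintegral_comp_norm_plane (hw.mul hL)
  rw [show ∫⁻ x : Plane, w ‖x‖ * L ‖x‖ = _ from hpolar,
    ← lintegral_const_mul' _ _ ENNReal.ofReal_ne_top]
  refine setLIntegral_congr_fun measurableSet_Ioi fun r hr => ?_
  have hr0 : 0 < r := hr
  have hrα : 0 < r ^ α := Real.rpow_pos_of_pos hr0 _
  have hLr : L r = negExp (ENNReal.ofReal (lam * (Real.pi * r ^ 2 *
      (p * hyperS 0 1 α τ + (1 - p) * gammaDelta 1 α τ)))) := by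
    simp only [L]
    rw [lintegral_smul_measure, lintegral_one_sub_negExp_stationCost hα hτ hp0 hp1 hr0, smul_eq_mul,
      ← ENNReal.ofReal_mul hlam.le]
  have hexp0 : 0 ≤ p * hyperS 0 1 α τ + (1 - p) * gammaDelta 1 α τ := by
    have hS := one_le_hyperS_zero_one hα hτ
    exact add_nonneg (mul_nonneg hp0 (by linarith))
      (mul_nonneg (by linarith) (gammaDelta_one_nonneg hα hτ))
  have hpi := Real.pi_pos
  simp only [Pi.mul_apply, w]
  rw [hLr, negExp_ofReal (by positivity), negExp_ofReal (by positivity),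
    ← ENNReal.ofReal_mul hp0, ← ENNReal.ofReal_mul (by positivity),
    ← ENNReal.ofReal_mul (by positivity), ← ENNReal.ofReal_mul hlam.le]
  congr 1
  rw [coverageIntegrand, nearestDensity]
  -- Writing `p S = p (S - 1) + p`, the last term is the exponent in `nearestDensity`.
  have he : Real.exp (-(τ * σ ^ 2 * r ^ α / (P * C * N * servingGain)) -
      Real.pi * lam * r ^ 2 * (p * (hyperS 0 1 α τ - 1) + (1 - p) * gammaDelta 1 α τ)) *
      Real.exp (-(Real.pi * p * lam * r ^ 2)) =
      Real.exp (-(τ * σ ^ 2 * r ^ α / (P * C * N * servingGain))) *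
      Real.exp (-(lam * (Real.pi * r ^ 2 *
        (p * hyperS 0 1 α τ + (1 - p) * gammaDelta 1 α τ)))) := by
    rw [← Real.exp_add, ← Real.exp_add]
    congr 1
    ring
  linear_combination (-(2 * Real.pi * p * lam * r)) * he

end IsMacroTier

theorem theorem2 {Ω : Type*} [MeasurableSpace Ω] (μ : Measure Ω) [IsProbabilityMeasure μ]
    {Nc : ℕ} (ν : Measure (Fin Nc → Bool)) [IsProbabilityMeasure ν]
    (P C α σ lam : ℝ) (N : ℕ) (hP : 0 < P) (hC : 0 < C) (hα : 2 < α) (hlam : 0 < lam) (hN : 0 < N)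
    (X : ℕ → Ω → Plane) (cache : ℕ → Ω → Fin Nc → Bool) (h : ℕ → Ω → ℂ)
    (htier : IsMacroTier μ lam ν X cache h) (f : Fin Nc) (τ : ℝ) (hτ : 0 ≤ τ) :
    IntegrableOn (coverageIntegrand P C α σ lam (cacheProb ν f) τ N) (Set.Ioi 0) ∧
      coverageProb μ P C α σ N X cache h f τ =
        ∫ r in Set.Ioi (0 : ℝ), coverageIntegrand P C α σ lam (cacheProb ν f) τ N r := by
  have hcov := htier.measure_coverage_eq_lintegral (f := f) σ hP hC hα hlam hN hτ
  have hm : Measurable (coverageIntegrand P C α σ lam (cacheProb ν f) τ N) := by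
    unfold coverageIntegrand nearestDensity
    fun_prop
  have hnonneg : 0 ≤ᵐ[volume.restrict (Ioi 0)]
      coverageIntegrand P C α σ lam (cacheProb ν f) τ N := by
    filter_upwards [ae_restrict_mem measurableSet_Ioi] with r hr
    have hp0 : 0 ≤ cacheProb ν f := cacheProb_nonneg
    have hr0 : 0 < r := hr
    have hpi := Real.pi_pos
    simp only [Pi.zero_apply, coverageIntegrand, nearestDensity]
    positivity
  refine ⟨⟨hm.aestronglyMeasurable, ?_⟩, ?_⟩
  -- Convergence is free: the integrand is nonnegative and its integral is a probability.
  · rw [hasFiniteIntegral_iff_ofReal hnonneg, ← hcov]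
    exact measure_lt_top μ _
  · rw [integral_eq_lintegral_of_nonneg_ae hnonneg hm.aestronglyMeasurable, ← hcov]
    rfl
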